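/- Let $M$ be a (real, smooth) supermanifold of dimension $n|m$ with local coordinates $x^a$ of parity $\tilde a$ and left derivatives $\partial_a$, and let $\mathfrak V(M)$ be the (sheaf of) commutative superalgebra(s) of densities on $M$, whose local elements are finite sums $\sum_w \psi_w(x)\,(Dx)^w$, $w\in\mathbb R$, with $(Dx')^w=|\mathrm{Ber}(\partial x'/\partial x)|^w (Dx)^w$. Let $\{\,\cdot\,;\,\cdot\,\}$ be an odd long bracket of weight $0$ on $M$, i.e. an odd bilinear operation on densities (compatible with restriction to open subsets and with changes of coordinates) preserving the total weight, with $\{\psi;\chi\}=(-1)^{\tilde\psi\tilde\chi}\{\chi;\psi\}$, $\{\psi;\chi\varphi\}=\{\psi;\chi\}\varphi+(-1)^{(\tilde\psi+1)\tilde\chi}\chi\{\psi;\varphi\}$ and $\{\psi;(Dx)^w\}=w\,(Dx)^{w-1}\{\psi;Dx\}$ for all $w \in \mathbb R$. In local coordinates put $$\{x^a;x^b\}=S^{ab},\qquad \{x^a;Dx\}=\gamma^a\,Dx,\qquad \{Dx;Dx\}=\theta\,(Dx)^2 .$$ Suppose that $S^{ab}$ is non-degenerate, i.e. in every chart the matrix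 $(S^{ab})$ is invertible; let $(\omega_{ab})$ be the inverse matrix and $\gamma_a=\omega_{ab}\gamma^b$. Then the long bracket satisfies the Jacobi identity $$(-1)^{\tilde\psi\tilde\varphi}\{\{\psi;\chi\};\varphi\}+(-1)^{\tilde\varphi\tilde\chi}\{\{\varphi;\psi\};\chi\}+(-1)^{\tilde\chi\tilde\psi}\{\{\chi;\varphi\};\psi\}=0$$ for all homogeneous densities $\psi,\chi,\varphi$ (defined on open subsets of charts) if and only if the following three conditions hold in every chart: 1. $M$ is odd symplectic: $\omega=\tfrac12\,dx^a\,dx^b\,\omega_{ba}$ is an odd symplectic form (odd, non-degenerate, $d\omega=0$); 2. near every point there is a local volume form $\rho\,Dx$, $\rho=e^{\mathscr A}$ with $\mathscr A=\log\rho$ an even function, such that $\gamma^a=-S^{ab}\,\partial_b\mathscr A=-S^{ab}\,\partial_b\log\rho$; 3. $\theta=\gamma^a\gamma_a$. -/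

import Mathlib

open scoped TensorProduct ContDiff
open TopologicalSpace (Opens)

noncomputable section

namespace OddLongBracket

/-! ### Smooth functions on open subsets of `ℝⁿ` -/

/-- The even coordinate space `ℝⁿ`. -/
abbrev E (n : ℕ) := EuclideanSpace ℝ (Fin n)

/-- Extension by zero of a function on an open set (an auxiliary total function, used only on
the open set itself). -/
def ext {n : ℕ} {W : Opens (E n)} (f : W → ℝ) : E n → ℝ := Function.extend Subtype.val f 0

theorem ext_apply {n : ℕ} {W : Opens (E n)} (f : W → ℝ) {x : E n} (hx : x ∈ W) :
    ext f x = f ⟨x, hx⟩ :=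
  Subtype.val_injective.extend_apply f 0 ⟨x, hx⟩

/-- The algebra `C^∞(W)` of smooth real functions on the open set `W ⊆ ℝⁿ`. -/
def Smooth {n : ℕ} (W : Opens (E n)) : Subalgebra ℝ (W → ℝ) where
  carrier := {f | ContDiffOn ℝ ∞ (ext f) W}
  mul_mem' {f g} hf hg := (ContDiffOn.mul hf hg).congr fun x hx => by
    simp [ext_apply _ (show x ∈ W from hx)]
  add_mem' {f g} hf hg := (ContDiffOn.add hf hg).congr fun x hx => by
    simp [ext_apply _ (show x ∈ W from hx)]
  algebraMap_mem' c := (contDiffOn_const (c := c)).congr fun x hx => by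
    rw [ext_apply _ hx]; rfl

/-- Restriction of smooth functions to a smaller open set. -/
def Smooth.res {n : ℕ} {W' W : Opens (E n)} (h : W' ≤ W) : Smooth W →ₐ[ℝ] Smooth W' where
  toFun f := ⟨fun x => f.1 ⟨x.1, h x.2⟩, (ContDiffOn.mono f.2 h).congr fun x hx => by
    rw [ext_apply _ hx, ext_apply _ (h hx)]⟩
  map_one' := rfl
  map_mul' _ _ := rfl
  map_zero' := rfl
  map_add' _ _ := rfl
  commutes' _ := rfl

/-- The partial derivative `∂/∂xⁱ` of smooth functions. -/
def Smooth.pderiv {n : ℕ} {W : Opens (E n)} (i : Fin n) : Smooth W →ₗ[ℝ] Smooth W where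
  toFun f := ⟨fun x => fderiv ℝ (ext f.1) x (EuclideanSpace.single i 1), by
    have h : ContDiffOn ℝ ∞ (fun x => fderiv ℝ (ext f.1) x (EuclideanSpace.single i 1)) W :=
      (ContDiffOn.fderiv_of_isOpen f.2 W.isOpen le_rfl).clm_apply contDiffOn_const
    exact h.congr fun x hx => by rw [ext_apply _ hx]⟩
  map_add' f g := by
    have key (f : Smooth W) (x : W) : DifferentiableAt ℝ (ext f.1) x :=
      (ContDiffOn.contDiffAt f.2 (W.isOpen.mem_nhds x.2)).differentiableAt (by simp)
    ext x
    have : ext (f + g).1 =ᶠ[nhds (x : E n)] ext f.1 + ext g.1 :=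
      Filter.eventually_of_mem (W.isOpen.mem_nhds x.2) fun y hy => by
        rw [Pi.add_apply, ext_apply _ hy, ext_apply _ hy, ext_apply _ hy]; rfl
    change fderiv ℝ (ext (f + g).1) x _ = fderiv ℝ (ext f.1) x _ + fderiv ℝ (ext g.1) x _
    rw [this.fderiv_eq, fderiv_add (key f x) (key g x)]; rfl
  map_smul' c f := by
    have key (f : Smooth W) (x : W) : DifferentiableAt ℝ (ext f.1) x :=
      (ContDiffOn.contDiffAt f.2 (W.isOpen.mem_nhds x.2)).differentiableAt (by simp)
    ext x
    have : ext (c • f).1 =ᶠ[nhds (x : E n)] c • ext f.1 :=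
      Filter.eventually_of_mem (W.isOpen.mem_nhds x.2) fun y hy => by
        rw [Pi.smul_apply, ext_apply _ hy, ext_apply _ hy]; rfl
    change fderiv ℝ (ext (c • f).1) x _ = c * fderiv ℝ (ext f.1) x _
    rw [this.fderiv_eq, fderiv_const_smul (key f x)]; rfl

/-- The coordinate function `xⁱ`. -/
def Smooth.coord {n : ℕ} (W : Opens (E n)) (i : Fin n) : Smooth W :=
  ⟨fun x => x.1 i, by
    have h : ContDiffOn ℝ ∞ (fun x : E n => x i) W :=
      (EuclideanSpace.proj (𝕜 := ℝ) i).contDiff.contDiffOn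
    exact h.congr fun x hx => by rw [ext_apply _ hx]⟩

/-- The exponential of a smooth function. -/
def Smooth.exp {n : ℕ} {W : Opens (E n)} (f : Smooth W) : Smooth W :=
  ⟨fun x => Real.exp (f.1 x), by
    have h : ContDiffOn ℝ ∞ (fun x => Real.exp (ext f.1 x)) W := ContDiffOn.exp f.2
    exact h.congr fun x hx => by rw [ext_apply _ hx, ext_apply _ hx]⟩

/-! ### Functions on superdomains -/

/-- The Grassmann algebra `Λ(ξ¹, …, ξᵐ)` over `ℝ`. -/
abbrev Gr (m : ℕ) := ExteriorAlgebra ℝ (Fin m → ℝ)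

/-- The superalgebra `C^∞(W) ⊗ Λ(ξ¹, …, ξᵐ)` of functions on the superdomain `W^{n|m}`. -/
def SF (n m : ℕ) (W : Opens (E n)) : Type := Smooth W ⊗[ℝ] Gr m

instance (n m : ℕ) (W : Opens (E n)) : Ring (SF n m W) :=
  inferInstanceAs (Ring (Smooth W ⊗[ℝ] Gr m))

instance (n m : ℕ) (W : Opens (E n)) : Algebra ℝ (SF n m W) :=
  inferInstanceAs (Algebra ℝ (Smooth W ⊗[ℝ] Gr m))

/-- The identity map `SF n m W → C^∞(W) ⊗ Λ(ξ¹, …, ξᵐ)`. -/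
def SF.equiv (n m : ℕ) (W : Opens (E n)) : SF n m W ≃ₐ[ℝ] Smooth W ⊗[ℝ] Gr m :=
  AlgEquiv.refl (A₁ := Smooth W ⊗[ℝ] Gr m)

/-- The element `f ⊗ η`. -/
def SF.tmul {n m : ℕ} {W : Opens (E n)} (f : Smooth W) (η : Gr m) : SF n m W :=
  (SF.equiv n m W).symm (f ⊗ₜ η)

/-- Indices of the coordinates `xᵃ`: `n` even ones followed by `m` odd ones. -/
abbrev Idx (n m : ℕ) := Fin n ⊕ Fin m

/-- The parity `ã` of the coordinate with index `a`. -/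
def par {n m : ℕ} : Idx n m → ZMod 2 := Sum.elim (fun _ => 0) (fun _ => 1)

/-- The sign `(-1)^p`. -/
def sgn (p : ZMod 2) : ℝ := if p = 0 then 1 else -1

section SF
variable {n m : ℕ} {W : Opens (E n)}

/-- The homogeneous functions of parity `p`. -/
def parity (n m : ℕ) (W : Opens (E n)) (p : ZMod 2) : Submodule ℝ (SF n m W) :=
  (LinearMap.range (LinearMap.lTensor (Smooth W)
    (CliffordAlgebra.evenOdd (0 : QuadraticForm ℝ (Fin m → ℝ)) p).subtype)).comap
      (SF.equiv n m W).toLinearMap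

/-- Restriction to a smaller open set. -/
def SF.res {W' : Opens (E n)} (h : W' ≤ W) : SF n m W →ₐ[ℝ] SF n m W' :=
  (SF.equiv n m W').symm.toAlgHom.comp
    ((Algebra.TensorProduct.map (Smooth.res h) (AlgHom.id ℝ (Gr m))).comp
      (SF.equiv n m W).toAlgHom)

/-- The value at `ξ = 0`, i.e. restriction to the underlying ordinary manifold. -/
def SF.body : SF n m W →ₐ[ℝ] Smooth W :=
  (Algebra.TensorProduct.rid ℝ ℝ (Smooth W)).toAlgHom.comp
    ((Algebra.TensorProduct.map (AlgHom.id ℝ (Smooth W)) ExteriorAlgebra.algebraMapInv).comp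
      (SF.equiv n m W).toAlgHom)

/-- The coordinates `xᵃ` (even and odd). -/
def coord (n m : ℕ) (W : Opens (E n)) : Idx n m → SF n m W :=
  Sum.elim (fun i => SF.tmul (Smooth.coord W i) 1)
    (fun j => SF.tmul 1 (ExteriorAlgebra.ι ℝ (Pi.single j 1)))

/-- The (left) partial derivatives `∂ₐ = ∂/∂xᵃ`. -/
def pd (a : Idx n m) : SF n m W →ₗ[ℝ] SF n m W :=
  (SF.equiv n m W).symm.toLinearMap ∘ₗ
    Sum.elim (fun i => LinearMap.rTensor (Gr m) (Smooth.pderiv i))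
      (fun j => LinearMap.lTensor (Smooth W)
        (CliffordAlgebra.contractLeft (Q := (0 : QuadraticForm ℝ (Fin m → ℝ)))
          (LinearMap.proj j))) a ∘ₗ
    (SF.equiv n m W).toLinearMap

/-- The exponential of a function on a superdomain: with `f = b + ν`, where `b` is the body and
`ν` is nilpotent (`ν ^ (m + 1) = 0`), it is `exp b · ∑ₖ νᵏ / k!`. -/
def SF.exp (f : SF n m W) : SF n m W :=
  SF.tmul (Smooth.exp (SF.body f)) 1 *
    ∑ k ∈ Finset.range (m + 1), ((k.factorial : ℝ)⁻¹) • (f - SF.tmul (SF.body f) 1) ^ k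

/-! ### The Berezinian -/

/-- The determinant (Leibniz formula) of a matrix with even, hence pairwise commuting, entries. -/
def evenDet {k : ℕ} (A : Matrix (Fin k) (Fin k) (SF n m W)) : SF n m W :=
  ∑ σ : Equiv.Perm (Fin k), ((Equiv.Perm.sign σ : ℤ) : ℝ) •
    (List.ofFn fun i => A (σ i) i).prod

/-- The Berezinian `det (A - B D⁻¹ C) · (det D)⁻¹` of an even invertible matrix with blocks
`A B C D`. -/
def ber (X : Matrix (Idx n m) (Idx n m) (SF n m W)) : SF n m W :=
  evenDet (X.toBlocks₁₁ - X.toBlocks₁₂ * Ring.inverse X.toBlocks₂₂ * X.toBlocks₂₁) *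
    Ring.inverse (evenDet X.toBlocks₂₂)

/-- `l = log |J|`, for an invertible even `J`: the equation `exp (2 l) = J²`. -/
def IsLogAbs (l J : SF n m W) : Prop := SF.exp ((2 : ℝ) • l) = J ^ 2

end SF

/-! ### Supermanifolds -/

/-- The change of coordinates from chart `i` to chart `j` is defined on `W` and maps `W`
into `W'`. -/
def ChartMaps {n : ℕ} {M I : Type*} [TopologicalSpace M]
    (chart : I → OpenPartialHomeomorph M (E n)) (i j : I) (W W' : Opens (E n)) : Prop :=
  (W : Set (E n)) ⊆ (chart i).target ∧ (W' : Set (E n)) ⊆ (chart j).target ∧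
    ∀ x ∈ W, (chart i).symm x ∈ (chart j).source ∧ chart j ((chart i).symm x) ∈ W'

/-- A supermanifold of dimension `n|m` with underlying topological space `M`: an atlas of charts
onto open sets `dom i ⊆ ℝⁿ`, whose transition maps are isomorphisms of superdomains, i.e.
compatible families of even homomorphisms between the algebras of functions, lying over the
transition maps of `M` and satisfying the cocycle condition. -/
structure Supermanifold (n m : ℕ) (M : Type*) [TopologicalSpace M] where
  /-- indices of the charts -/
  I : Type*
  chart : I → OpenPartialHomeomorph M (E n)
  cover : ∀ p : M, ∃ i, p ∈ (chart i).source
  /-- The pull-back of functions from `W'` in chart `j` to `W` in chart `i`, whenever `W` is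
  contained in the overlap and the change of coordinates takes `W` into `W'`. -/
  pull : ∀ (i j : I) (W W' : Opens (E n)), ChartMaps chart i j W W' →
    (SF n m W' →ₐ[ℝ] SF n m W)
  pull_parity : ∀ i j W W' h p, ∀ f ∈ parity n m W' p, pull i j W W' h f ∈ parity n m W p
  pull_body : ∀ (i j : I) (W W' : Opens (E n)) (h : ChartMaps chart i j W W') (f : SF n m W')
    (x : W),
    (SF.body (pull i j W W' h f)).1 x =
      (SF.body f).1 ⟨chart j ((chart i).symm x), (h.2.2 x.1 x.2).2⟩
  pull_res : ∀ i j W W' h V V' h' (hV : V ≤ W) (hV' : V' ≤ W') f,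
    pull i j V V' h' (SF.res hV' f) = SF.res hV (pull i j W W' h f)
  pull_self : ∀ i W h f, pull i i W W h f = f
  pull_comp : ∀ i j k W W' W'' h h' h'' f,
    pull i j W W' h (pull j k W' W'' h' f) = pull i k W W'' h'' f

namespace Supermanifold
variable {n m : ℕ} {M : Type*} [TopologicalSpace M] (X : Supermanifold n m M)

/-- The coordinate domain of the chart `i`. -/
def dom (i : X.I) : Opens (E n) := ⟨(X.chart i).target, (X.chart i).open_target⟩

/-- The Jacobian `J = Dx'/Dx`, the Berezinian of the matrix `∂x^{a'}/∂xᵃ` of the change from the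
coordinates `x` of chart `i` to the coordinates `x'` of chart `j`. -/
def jac {i j : X.I} {W W' : Opens (E n)} (h : ChartMaps X.chart i j W W') : SF n m W :=
  ber (Matrix.of fun a a' => pd a (X.pull i j W W' h (coord n m W' a')))

end Supermanifold

/-! ### Densities -/

/-- The algebra of densities on a superdomain: finite formal sums `∑ ψ_w (Dx)^w` over real
weights `w`, with `(Dx)^w (Dx)^{w'} = (Dx)^{w + w'}`. -/
abbrev Dens (n m : ℕ) (W : Opens (E n)) := AddMonoidAlgebra (SF n m W) ℝ

section Dens
variable {n m : ℕ} {W : Opens (E n)}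

/-- The density `f (Dx)^w`. -/
abbrev dens (w : ℝ) (f : SF n m W) : Dens n m W := AddMonoidAlgebra.single w f

/-- Parity of densities (`Dx` is even). -/
def Dens.HasParity (ψ : Dens n m W) (p : ZMod 2) : Prop := ∀ w, ψ.coeff w ∈ parity n m W p

/-- Restriction to a smaller open set. -/
def Dens.res {W' : Opens (E n)} (h : W' ≤ W) : Dens n m W →ₐ[ℝ] Dens n m W' :=
  AddMonoidAlgebra.mapAlgHom ℝ (SF.res h)

/-- The transformation of densities under a change of coordinates `φ` with `l = log |Dx'/Dx|`:
`∑ ψ_w(x') (Dx')^w ↦ ∑ ψ_w(x'(x)) |Dx'/Dx|^w (Dx)^w`. -/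
def Dens.pull {W' : Opens (E n)} (φ : SF n m W' →ₐ[ℝ] SF n m W) (l : SF n m W)
    (ψ : Dens n m W') : Dens n m W :=
  ψ.coeff.sum fun w f => dens w (φ f * SF.exp (w • l))

/-- An odd bracket of weight `0` in the algebra of densities: an odd symmetric bi-derivation which
preserves the total weight. A density is a function of the coordinates `xᵃ` and of `t = Dx`, and
`chain` is the chain rule for the functions `t^w`, `w ∈ ℝ`: `{ψ; t^w} = w t^{w-1} {ψ; t}`. -/
structure IsOddBracket (B : Dens n m W →ₗ[ℝ] Dens n m W →ₗ[ℝ] Dens n m W) : Prop where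
  odd : ∀ ψ χ p q, Dens.HasParity ψ p → Dens.HasParity χ q →
    Dens.HasParity (B ψ χ) (p + q + 1)
  symm : ∀ ψ χ p q, Dens.HasParity ψ p → Dens.HasParity χ q → B ψ χ = sgn (p * q) • B χ ψ
  leibniz : ∀ ψ χ φ p q, Dens.HasParity ψ p → Dens.HasParity χ q →
    B ψ (χ * φ) = B ψ χ * φ + sgn ((p + 1) * q) • (χ * B ψ φ)
  weight : ∀ w₁ w₂ f g, ∃ h, B (dens w₁ f) (dens w₂ g) = dens (w₁ + w₂) h
  chain : ∀ ψ w, B ψ (dens w 1) = w • (dens (w - 1) 1 * B ψ (dens 1 1))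

end Dens

/-! ### Long brackets -/

/-- An odd long bracket of weight `0` on a supermanifold: a bracket in the sheaf of algebras of
densities, given on the open subsets of the charts, compatible with restrictions and with changes
of coordinates. -/
structure LongBracket {n m : ℕ} {M : Type*} [TopologicalSpace M] (X : Supermanifold n m M) where
  br : ∀ (i : X.I) (W : Opens (E n)), W ≤ X.dom i →
    Dens n m W →ₗ[ℝ] Dens n m W →ₗ[ℝ] Dens n m W
  isBracket : ∀ i W hW, IsOddBracket (br i W hW)
  res : ∀ i W hW W' (h : W' ≤ W) ψ χ,
    Dens.res h (br i W hW ψ χ) = br i W' (h.trans hW) (Dens.res h ψ) (Dens.res h χ)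
  trans : ∀ i j W W' (h : ChartMaps X.chart i j W W') (l : SF n m W), IsLogAbs l (X.jac h) → ∀ ψ χ,
    Dens.pull (X.pull i j W W' h) l (br j W' h.2.1 ψ χ) =
      br i W h.1 (Dens.pull (X.pull i j W W' h) l ψ) (Dens.pull (X.pull i j W W' h) l χ)

/-- `ω = ½ dxᵃ dxᵇ ω_{ba}` is an odd symplectic form. The `dxᵃ` have parity `ã + 1` and commute
accordingly, the form is odd, closed and non-degenerate. The last
field is the vanishing of the coefficients of
`dω = ½ dxᶜ ∂_c (dxᵃ dxᵇ ω_{ba}) = ½ (-1)^{c̃(ã+b̃)} dxᶜ dxᵃ dxᵇ ∂_c ω_{ba}`. -/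
structure IsOddSymplectic {n m : ℕ} {W : Opens (E n)}
    (om : Matrix (Idx n m) (Idx n m) (SF n m W)) : Prop where
  odd : ∀ a b, om a b ∈ parity n m W (par a + par b + 1)
  symm : ∀ a b, om a b = sgn ((par a + 1) * (par b + 1)) • om b a
  nondegenerate : IsUnit om
  closed : ∀ a b c,
    sgn (par c * (par a + par b)) • pd c (om b a)
      + sgn ((par c + 1) * (par a + par b)) • sgn (par a * (par b + par c)) • pd a (om c b)
      + sgn ((par b + 1) * (par c + par a)) • sgn (par b * (par c + par a)) • pd b (om a c) = 0

namespace LongBracket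
variable {n m : ℕ} {M : Type*} [TopologicalSpace M] {X : Supermanifold n m M}
  (B : LongBracket X) (i : X.I)

/-- The coefficients `S^{ab}` in the chart `i`: `{xᵃ; xᵇ} = S^{ab}`. -/
def S : Matrix (Idx n m) (Idx n m) (SF n m (X.dom i)) := Matrix.of fun a b =>
  (B.br i (X.dom i) le_rfl (dens 0 (coord n m _ a)) (dens 0 (coord n m _ b))).coeff 0

/-- The coefficients `γᵃ` in the chart `i`: `{xᵃ; Dx} = γᵃ Dx`. -/
def gamma (a : Idx n m) : SF n m (X.dom i) :=
  (B.br i (X.dom i) le_rfl (dens 0 (coord n m _ a)) (dens 1 1)).coeff 1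

/-- The coefficient `θ` in the chart `i`: `{Dx; Dx} = θ (Dx)²`. -/
def theta : SF n m (X.dom i) :=
  (B.br i (X.dom i) le_rfl (dens 1 1) (dens 1 1)).coeff 2

/-- The matrix `(ω_{ab})` inverse to `(S^{ab})`. -/
def omega : Matrix (Idx n m) (Idx n m) (SF n m (X.dom i)) := Ring.inverse (B.S i)

/-- Lowering the index: `γₐ = ω_{ab} γᵇ`. -/
def gammaLow (a : Idx n m) : SF n m (X.dom i) := ∑ b, B.omega i a b * B.gamma i b

/-- The Jacobi identity for the long bracket. -/
def Jacobi : Prop := ∀ (i : X.I) (W : Opens (E n)) (hW : W ≤ X.dom i) (ψ χ φ : Dens n m W)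
  (p q r : ZMod 2), ψ.HasParity p → χ.HasParity q → φ.HasParity r →
    sgn (p * r) • B.br i W hW (B.br i W hW ψ χ) φ
      + sgn (r * q) • B.br i W hW (B.br i W hW φ ψ) χ
      + sgn (q * p) • B.br i W hW (B.br i W hW χ φ) ψ = 0

end LongBracket

end OddLongBracket

end

noncomputable section

namespace OddLongBracket

/-! For homogeneous densities `{ψ; ·}` is a superderivation, and the Jacobi expression is, up to
sign, the `defect`: the difference between `{{ψ; χ}; ·}` and a supercommutator of `{ψ; ·}` and `{χ;
·}`. The defect is again a superderivation, compatible with restriction, so by Hadamard's lemma and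
the chain rule for `(Dx)^w` it vanishes as soon as it kills the coordinates and `Dx`. Cyclic
symmetry then reduces the Jacobi identity to the generators. Writing `{Dx; f} = Γ(f) Dx` with `Γ =
γᵃ∂ₐ`, four families of equations remain: `J0` for `xᵃ, xᵇ, xᶜ`; `J1` for `xᵃ, xᵇ, Dx`; `J2` for
`xᵃ, Dx, Dx`; and `Γ(θ) = 0` for `Dx, Dx, Dx`.

Non-degeneracy translates them. Since `∂S = -S (∂ω) S` up to signs, `J0` is `dω` contracted with
three copies of `S`, so it vanishes exactly when `ω` is closed (`J0_eq`, `J0_eq_zero_iff`).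
Substituting `γᵃ = S^{ab}γ_b` turns `J1` into `J0` contracted with `γ`, plus the exterior derivative
of `γₐ` contracted with two copies of `S` (`J1_eq`). Thus `J0 = J1 = 0` makes the 1-form `γₐ`
closed, and the super Poincaré lemma gives a local even potential `A` with `γᵃ = -{xᵃ; A}`.

Once a potential exists, `{A; f} = -Γ(f)` on functions, so `A` stands in for `Dx`: the Jacobi
identities of the functions `(xᵃ, xᵇ, A)`, `(xᵃ, A, A)` and `(A, A, A)`, all consequences of `J0`,
give `J1 = 0`, then `J2 = ±{xᵃ; θ + Γ(A)}`, and `Γ(Γ(A)) = 0`. Moreover `γₐ = -∂ₐA`, so `γᵃγₐ =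
-Γ(A)`. If Jacobi holds, `θ + Γ(A)` has zero derivatives and is odd; an odd function with this
property is zero, which is condition 3. Conversely, condition 3 kills `J2` and gives `Γ(θ) =
-Γ(Γ(A)) = 0`. -/

/-! ### Real analysis: parametric integrals, Hadamard's lemma, cut-offs. -/

/-- The derivative of such an integral is an integral of the same kind with values in `V →L[ℝ] G`,
which is why `G` and `F` are quantified inside the induction on `k`. -/
theorem contDiff_parametric_integral_nat {V : Type} [NormedAddCommGroup V] [NormedSpace ℝ V]
    [ProperSpace V] (k : ℕ) : ∀ {G : Type} [NormedAddCommGroup G] [NormedSpace ℝ G]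
    [CompleteSpace G] {F : V → ℝ → G}, ContDiff ℝ ∞ (Function.uncurry F) →
    ContDiff ℝ k (fun x => ∫ t in (0 : ℝ)..1, F x t) := by
  have hderiv : ∀ {G : Type} [NormedAddCommGroup G] [NormedSpace ℝ G]
      [CompleteSpace G] {F : V → ℝ → G}, ContDiff ℝ ∞ (Function.uncurry F) →
      ContDiff ℝ ∞ (Function.uncurry fun x t => fderiv ℝ (fun y => F y t) x) ∧ ∀ x,
      HasFDerivAt (fun x => ∫ t in (0 : ℝ)..1, F x t)
        (∫ t in (0 : ℝ)..1, fderiv ℝ (fun y => F y t) x) x := by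
    intro G _ _ _ F hF
    have hsm : ContDiff ℝ ∞ (Function.uncurry fun x t => fderiv ℝ (fun y => F y t) x) := by
      have h1 : ContDiff ℝ ∞ (fun p : V × ℝ => fderiv ℝ (fun y => F y p.2) p.1) := by
        refine ContDiff.fderiv (f := fun (p : V × ℝ) y => F y p.2) (n := ∞) ?_ contDiff_fst le_rfl
        exact hF.comp (contDiff_snd.prodMk (contDiff_snd.comp contDiff_fst))
      exact h1
    refine ⟨hsm, fun x => ?_⟩
    -- Compactness of the unit ball times `[0, 1]` provides a constant that dominates the derivative
    -- near `x`.
    obtain ⟨C, hC⟩ := ((isCompact_closedBall x 1).prod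
      (isCompact_Icc (a := (0 : ℝ)) (b := 1))).exists_bound_of_continuousOn hsm.continuous.continuousOn
    have hcont : ∀ y, Continuous (F y) := fun y =>
      hF.continuous.comp (Continuous.prodMk continuous_const continuous_id)
    refine (intervalIntegral.hasFDerivAt_integral_of_dominated_of_fderiv_le
      (F := F) (F' := fun x t => fderiv ℝ (fun y => F y t) x) (bound := fun _ => C)
      (Metric.ball_mem_nhds x one_pos) ?_ ?_ ?_ ?_ ?_ ?_)
    · exact Filter.Eventually.of_forall fun y => (hcont y).aestronglyMeasurable
    · exact (hcont x).intervalIntegrable _ _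
    · exact (hsm.continuous.comp (Continuous.prodMk continuous_const continuous_id)).aestronglyMeasurable
    · refine Filter.Eventually.of_forall fun t ht y hy => ?_
      rw [Set.uIoc_of_le zero_le_one] at ht
      exact hC (y, t) ⟨Metric.ball_subset_closedBall hy, Set.Ioc_subset_Icc_self ht⟩
    · exact intervalIntegrable_const
    · refine Filter.Eventually.of_forall fun t _ y _ => ?_
      have : ContDiff ℝ ∞ (fun y => F y t) := hF.comp (contDiff_id.prodMk contDiff_const)
      exact (this.differentiable (by simp) y).hasFDerivAt
  induction k with
  | zero =>
    intro G _ _ _ F hF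
    exact contDiff_zero.2 (continuous_iff_continuousAt.2 fun x => ((hderiv hF).2 x).continuousAt)
  | succ k ih =>
    intro G _ _ _ F hF
    refine contDiff_succ_iff_hasFDerivAt.2 ⟨_, ih (hderiv hF).1, (hderiv hF).2⟩

theorem contDiff_parametric_integral {V : Type} [NormedAddCommGroup V] [NormedSpace ℝ V]
    [ProperSpace V] {G : Type} [NormedAddCommGroup G] [NormedSpace ℝ G]
    [CompleteSpace G] {F : V → ℝ → G} (hF : ContDiff ℝ ∞ (Function.uncurry F)) :
    ContDiff ℝ ∞ (fun x => ∫ t in (0 : ℝ)..1, F x t) :=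
  contDiff_infty.2 fun k => contDiff_parametric_integral_nat k hF

/-- The fundamental theorem of calculus along the segment from `x₀` to `x`; `g x` is the average of
the derivative of `f` on it. Global smoothness keeps the segment inside the domain. -/
theorem exists_hadamard {V : Type} [NormedAddCommGroup V] [NormedSpace ℝ V]
    [ProperSpace V] {f : V → ℝ} (hf : ContDiff ℝ ∞ f) (x₀ : V) :
    ∃ g : V → V →L[ℝ] ℝ, ContDiff ℝ ∞ g ∧ ∀ x, f x = f x₀ + g x (x - x₀) := by
  refine ⟨fun x => ∫ t in (0 : ℝ)..1, fderiv ℝ f (x₀ + t • (x - x₀)),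
    contDiff_parametric_integral (F := fun x t => fderiv ℝ f (x₀ + t • (x - x₀))) ?_, fun x => ?_⟩
  · refine (hf.fderiv_right (m := ∞) le_rfl).comp ?_
    exact contDiff_const.add (contDiff_snd.smul (contDiff_fst.sub contDiff_const))
  · have hc : Continuous fun t : ℝ => fderiv ℝ f (x₀ + t • (x - x₀)) :=
      (hf.continuous_fderiv (by simp)).comp (by fun_prop)
    change f x = f x₀ + (∫ t in (0 : ℝ)..1, fderiv ℝ f (x₀ + t • (x - x₀))) (x - x₀)
    rw [ContinuousLinearMap.intervalIntegral_apply (hc.intervalIntegrable _ _)]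
    have hd : ∀ t ∈ Set.uIcc (0 : ℝ) 1, HasDerivAt (fun t : ℝ => f (x₀ + t • (x - x₀)))
        (fderiv ℝ f (x₀ + t • (x - x₀)) (x - x₀)) t := fun t _ => by
      have h1 : HasDerivAt (fun t : ℝ => x₀ + t • (x - x₀)) (x - x₀) t := by
        simpa using ((hasDerivAt_id t).smul_const (x - x₀)).const_add x₀
      exact (hf.differentiable (by simp) _).hasFDerivAt.comp_hasDerivAt t h1
    rw [intervalIntegral.integral_eq_sub_of_hasDerivAt hd
      ((hc.clm_apply continuous_const).intervalIntegrable _ _)]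
    simp

/-- Multiplication by a bump function supported inside `W` and equal to 1 near `x₀`. It lets the
global Hadamard lemma be applied to functions defined only on `W`. -/
theorem exists_contDiff_eqOn_nhds {V : Type} [NormedAddCommGroup V] [NormedSpace ℝ V]
    [FiniteDimensional ℝ V] {f : V → ℝ} {W : Set V} (hW : IsOpen W) (hf : ContDiffOn ℝ ∞ f W)
    {x₀ : V} (hx : x₀ ∈ W) :
    ∃ g : V → ℝ, ContDiff ℝ ∞ g ∧ ∃ U ⊆ W, IsOpen U ∧ x₀ ∈ U ∧ Set.EqOn g f U := by
  obtain ⟨r, hr, hrW⟩ := Metric.isOpen_iff.1 hW x₀ hx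
  let b : ContDiffBump x₀ := ⟨r / 4, r / 2, by linarith, by linarith⟩
  refine ⟨fun x => b x * f x, ?_, Metric.ball x₀ (r / 4), ?_, Metric.isOpen_ball,
    Metric.mem_ball_self (by linarith), ?_⟩
  · rw [contDiff_iff_contDiffAt]
    intro x
    by_cases hxW : x ∈ W
    · exact b.contDiffAt.mul (hf.contDiffAt (hW.mem_nhds hxW))
    · have : (fun x => b x * f x) =ᶠ[nhds x] fun _ => 0 := by
        have hx' : x ∈ (Metric.closedBall x₀ (r / 2))ᶜ := fun h =>
          hxW (hrW (Metric.closedBall_subset_ball (by linarith) h))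
        filter_upwards [Metric.isClosed_closedBall.isOpen_compl.mem_nhds hx'] with y hy
        rw [b.zero_of_le_dist (not_le.1 fun h => hy (Metric.mem_closedBall.2 h)).le, zero_mul]
      exact contDiffAt_const.congr_of_eventuallyEq this
  · exact (Metric.ball_subset_ball (by linarith)).trans hrW
  · intro x hx
    have : b x = 1 := b.one_of_mem_closedBall (Metric.ball_subset_closedBall hx)
    simp [this]

theorem eq_sum_single {n : ℕ} (v : E n) : v = ∑ i, v i • EuclideanSpace.single i (1 : ℝ) := by
  ext j
  simp [Pi.single_apply]

/-! ### Calculus in `C^∞(W)` -/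

namespace Smooth
variable {n : ℕ} {W : Opens (E n)}

/-- The restriction to `W` of a total function that is smooth on `W`. -/
def of (g : E n → ℝ) (hg : ContDiffOn ℝ ∞ g W) : Smooth W :=
  ⟨fun x => g x, hg.congr fun _ hx => ext_apply _ hx⟩

theorem ext_eventuallyEq {g : E n → ℝ} {f : W → ℝ} (h : ∀ x : W, f x = g x) (x : W) :
    ext f =ᶠ[nhds (x : E n)] g :=
  Filter.eventually_of_mem (W.isOpen.mem_nhds x.2) fun y hy => by
    rw [ext_apply _ hy, h]

theorem pderiv_apply (i : Fin n) (f : Smooth W) (x : W) :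
    (pderiv i f).1 x = fderiv ℝ (ext f.1) x (EuclideanSpace.single i 1) := rfl

/-- Only the germ at a point of `W` matters, so the extension by zero may be replaced by whichever
total representative is convenient. -/
theorem pderiv_eq_of {i : Fin n} {f : Smooth W} {g : E n → ℝ} (h : ∀ x : W, f.1 x = g x) (x : W) :
    (pderiv i f).1 x = fderiv ℝ g x (EuclideanSpace.single i 1) := by
  rw [pderiv_apply, (ext_eventuallyEq h x).fderiv_eq]

theorem differentiableAt (f : Smooth W) (x : W) : DifferentiableAt ℝ (ext f.1) x :=
  (ContDiffOn.contDiffAt f.2 (W.isOpen.mem_nhds x.2)).differentiableAt (by simp)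

theorem pderiv_mul (i : Fin n) (f g : Smooth W) :
    pderiv i (f * g) = pderiv i f * g + f * pderiv i g := by
  ext x
  have h : ∀ x : W, (f * g).1 x = (ext f.1 * ext g.1) x := fun x => by
    rw [Pi.mul_apply, ext_apply _ x.2, ext_apply _ x.2]; rfl
  change (pderiv i (f * g)).1 x = (pderiv i f).1 x * g.1 x + f.1 x * (pderiv i g).1 x
  rw [pderiv_eq_of h, fderiv_mul (differentiableAt f x) (differentiableAt g x), pderiv_apply,
    pderiv_apply, ext_apply _ x.2, ext_apply _ x.2]
  simp only [add_apply, smul_apply, smul_eq_mul]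
  ring

theorem pderiv_one (i : Fin n) : pderiv i (1 : Smooth W) = 0 := by
  ext x
  change (pderiv i (1 : Smooth W)).1 x = 0
  rw [pderiv_eq_of (g := fun _ => 1) (fun _ => rfl)]
  simp

theorem pderiv_coord (i j : Fin n) : pderiv i (coord W j) = if i = j then 1 else 0 := by
  ext x
  rw [pderiv_eq_of (g := EuclideanSpace.proj (𝕜 := ℝ) j) (fun _ => rfl),
    ContinuousLinearMap.fderiv]
  split_ifs with h
  · subst h
    change (EuclideanSpace.proj i) (EuclideanSpace.single i (1 : ℝ)) = (1 : ℝ)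
    simp
  · change (EuclideanSpace.proj j) (EuclideanSpace.single i (1 : ℝ)) = (0 : ℝ)
    simp [h, eq_comm]

theorem pderiv_res {W' : Opens (E n)} (h : W' ≤ W) (i : Fin n) (f : Smooth W) :
    pderiv i (res h f) = res h (pderiv i f) := by
  ext x
  exact pderiv_eq_of (fun x => (ext_apply f.1 (h x.2)).symm) x

theorem pderiv_comm (i j : Fin n) (f : Smooth W) :
    pderiv i (pderiv j f) = pderiv j (pderiv i f) := by
  have key (i j : Fin n) (x : W) : (pderiv i (pderiv j f)).1 x =
      fderiv ℝ (fderiv ℝ (ext f.1)) x (EuclideanSpace.single i 1) (EuclideanSpace.single j 1) := by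
    have hd : DifferentiableAt ℝ (fderiv ℝ (ext f.1)) x :=
      ((ContDiffOn.fderiv_of_isOpen f.2 W.isOpen (m := ∞) le_rfl).contDiffAt
        (W.isOpen.mem_nhds x.2)).differentiableAt (by simp)
    rw [pderiv_eq_of (g := fun y => fderiv ℝ (ext f.1) y (EuclideanSpace.single j 1))
      (fun _ => rfl), fderiv_clm_apply hd (differentiableAt_const _)]
    simp
  ext x
  rw [key, key]
  have := ContDiffAt.isSymmSndFDerivAt (𝕜 := ℝ) (n := ∞) (f := ext f.1) (x := (x : E n))
    (ContDiffOn.contDiffAt f.2 (W.isOpen.mem_nhds x.2)) (by simpa using WithTop.coe_le_coe.2 (le_top : (2 : ℕ∞) ≤ ⊤))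
  exact this _ _

/-- Hadamard's lemma. -/
theorem exists_hadamard (f : Smooth W) (x₀ : W) :
    ∃ (U : Opens (E n)) (hU : U ≤ W) (_ : (x₀ : E n) ∈ U) (g : Fin n → Smooth U),
      res hU f = algebraMap ℝ _ (f.1 x₀) +
        ∑ i, (coord U i - algebraMap ℝ _ ((x₀ : E n) i)) * g i := by
  obtain ⟨F, hF, U, hUW, hUo, hxU, hUF⟩ := exists_contDiff_eqOn_nhds W.isOpen f.2 x₀.2
  obtain ⟨g, hg, hgF⟩ := OddLongBracket.exists_hadamard hF (x₀ : E n)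
  refine ⟨⟨U, hUo⟩, hUW, hxU, fun i => of (fun x => g x (EuclideanSpace.single i 1))
    (hg.clm_apply contDiff_const).contDiffOn, ?_⟩
  ext x
  have hx : (x : E n) - x₀ = ∑ i, ((x : E n) i - (x₀ : E n) i) • EuclideanSpace.single i (1 : ℝ) :=
    eq_sum_single _
  have h1 : f.1 ⟨x, hUW x.2⟩ = F x := by rw [hUF x.2, ext_apply]
  have h2 : f.1 x₀ = F x₀ := by rw [hUF hxU, ext_apply _ x₀.2]
  change f.1 ⟨x, hUW x.2⟩ = f.1 x₀ + (∑ i, _ : Smooth _).1 x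
  rw [h1, h2, hgF x, hx, map_sum]
  simp only [map_smul]
  congr 1
  rw [AddSubmonoidClass.coe_finsetSum, Finset.sum_apply]
  rfl

/-- The Poincaré lemma for 1-forms. -/
theorem exists_pderiv_eq (hW : Convex ℝ (W : Set (E n))) (g : Fin n → Smooth W)
    (hg : ∀ i j, pderiv i (g j) = pderiv j (g i)) : ∃ f : Smooth W, ∀ i, pderiv i f = g i := by
  let om : E n → E n →L[ℝ] ℝ := fun x => ∑ i, ext (g i).1 x • EuclideanSpace.proj (𝕜 := ℝ) i
  have hom : ContDiffOn ℝ ∞ om W :=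
    ContDiffOn.sum fun i _ => ContDiffOn.smul (g i).2 contDiffOn_const
  have hd : ∀ x ∈ W, HasFDerivAt om (∑ i, (fderiv ℝ (ext (g i).1) x).smulRight
      (EuclideanSpace.proj (𝕜 := ℝ) i : E n →L[ℝ] ℝ)) x := fun x hx =>
    HasFDerivAt.fun_sum fun i _ => HasFDerivAt.smul_const (𝕜' := ℝ) (F := E n →L[ℝ] ℝ)
      (differentiableAt (g i) ⟨x, hx⟩).hasFDerivAt (EuclideanSpace.proj i)
  obtain ⟨F, hF⟩ := hW.exists_forall_hasFDerivWithinAt_of_hasFDerivWithinAt_symmetric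
    (fun x hx => (hd x hx).hasFDerivWithinAt) fun x hx u _ v _ => by
      have h : ∀ i j, fderiv ℝ (ext (g i).1) x (EuclideanSpace.single j 1) =
          fderiv ℝ (ext (g j).1) x (EuclideanSpace.single i 1) := fun i j =>
        congrArg (fun f : Smooth W => f.1 ⟨x, hx⟩) (hg j i)
      -- In the standard basis, symmetry of the derivative of `om` becomes the assumed equality of
      -- the mixed partial derivatives.
      have h2 : ∀ u v : E n, (∑ i, (fderiv ℝ (ext (g i).1) x).smulRight
          (EuclideanSpace.proj (𝕜 := ℝ) i : E n →L[ℝ] ℝ)) u v =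
          ∑ i, ∑ j, u j * v i * fderiv ℝ (ext (g i).1) x (EuclideanSpace.single j 1) := by
        intro u v
        rw [sum_apply, sum_apply]
        refine Finset.sum_congr rfl fun i _ => ?_
        rw [ContinuousLinearMap.smulRight_apply, smul_apply]
        conv_lhs => rw [eq_sum_single u, map_sum]
        rw [smul_eq_mul, Finset.sum_mul]
        refine Finset.sum_congr rfl fun j _ => ?_
        rw [map_smul, smul_eq_mul, EuclideanSpace.coe_proj]
        ring
      rw [h2, h2, Finset.sum_comm]
      refine Finset.sum_congr rfl fun i _ => Finset.sum_congr rfl fun j _ => ?_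
      rw [h]
      ring
  have hF' : ∀ x ∈ W, HasFDerivAt F (om x) x := fun x hx =>
    (hF x hx).hasFDerivAt (W.isOpen.mem_nhds hx)
  -- The primitive is so far only differentiable; its derivative `om` is smooth, hence so is `F`.
  have hsm : ContDiffOn ℝ ∞ F W := by
    have h := (contDiffOn_succ_iff_fderiv_of_isOpen (𝕜 := ℝ) (n := ∞) (f := F) W.isOpen).2
      ⟨fun x hx => (hF' x hx).differentiableAt.differentiableWithinAt, by simp,
        hom.congr fun x hx => (hF' x hx).fderiv⟩
    exact h
  refine ⟨of F hsm, fun i => ?_⟩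
  ext x
  rw [pderiv_eq_of (g := F) (fun _ => rfl), (hF' x x.2).fderiv]
  simp only [om, sum_apply, smul_apply]
  rw [Finset.sum_eq_single i]
  · simp [ext_apply _ x.2]
  · intro j _ hj
    simp [hj]
  · simp

end Smooth

/-! ### Signs -/

@[simp] theorem sgn_zero : sgn 0 = 1 := rfl
@[simp] theorem sgn_one : sgn 1 = -1 := rfl

theorem zmod2_cases (p : ZMod 2) : p = 0 ∨ p = 1 := by
  fin_cases p
  exacts [Or.inl rfl, Or.inr rfl]

@[simp] theorem zmod2_one_add_one : (1 : ZMod 2) + 1 = 0 := rfl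

theorem sgn_add (p q : ZMod 2) : sgn (p + q) = sgn p * sgn q := by
  rcases zmod2_cases p with rfl | rfl <;> rcases zmod2_cases q with rfl | rfl <;> simp

@[simp] theorem sgn_mul_self (p : ZMod 2) : sgn p * sgn p = 1 := by
  rcases zmod2_cases p with rfl | rfl <;> simp

/-! ### The Grassmann algebra -/

section Gr
open CliffordAlgebra
variable {V : Type*} [AddCommGroup V] [Module ℝ V]

/-- By induction on the left factor, one vector at a time. This is the source of the signed Leibniz
rule for the odd derivatives. -/
theorem contractLeft_mul (d : Module.Dual ℝ V) (a b : ExteriorAlgebra ℝ V) :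
    contractLeft d (a * b) = contractLeft d a * b + involute a * contractLeft d b := by
  induction a using CliffordAlgebra.left_induction with
  | algebraMap r => simp [contractLeft_algebraMap_mul]
  | add x y hx hy => simp only [add_mul, map_add, hx, hy]; abel
  | ι_mul x v hx =>
    rw [mul_assoc, contractLeft_ι_mul, hx, contractLeft_ι_mul, map_mul, involute_ι, sub_mul,
      mul_add, mul_assoc, smul_mul_assoc, neg_mul, neg_mul, mul_assoc]
    abel

/-- Each transposition of two vectors costs a sign, and the grading involution counts them.
Supercommutativity of the Grassmann algebra follows from this case. -/
theorem ι_mul_eq_involute_mul (v : V) (a : ExteriorAlgebra ℝ V) :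
    ExteriorAlgebra.ι ℝ v * a = involute a * ExteriorAlgebra.ι ℝ v := by
  induction a using CliffordAlgebra.left_induction with
  | algebraMap r => simp [Algebra.commutes]
  | add x y hx hy => simp only [mul_add, map_add, add_mul, hx, hy]
  | ι_mul x w hx =>
    have h : ExteriorAlgebra.ι ℝ v * ExteriorAlgebra.ι ℝ w =
        -(ExteriorAlgebra.ι ℝ w * ExteriorAlgebra.ι ℝ v) :=
      eq_neg_of_add_eq_zero_left (ExteriorAlgebra.ι_add_mul_swap v w)
    rw [map_mul, involute_ι, mul_assoc, ← hx, ← mul_assoc, ← mul_assoc, h, neg_mul, neg_mul,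
      neg_mul]

theorem mul_comm_of_involute_eq {b : ExteriorAlgebra ℝ V} (hb : involute b = b)
    (a : ExteriorAlgebra ℝ V) : a * b = b * a := by
  induction a using CliffordAlgebra.left_induction with
  | algebraMap r => rw [Algebra.commutes]
  | add x y hx hy => rw [mul_add, add_mul, hx, hy]
  | ι_mul x v hx =>
    have := ι_mul_eq_involute_mul v b
    rw [hb] at this
    rw [mul_assoc, hx, ← mul_assoc, ← mul_assoc]
    exact congrArg (· * x) this

theorem mul_comm_of_involute_eq_neg {b : ExteriorAlgebra ℝ V} (hb : involute b = -b)
    (a : ExteriorAlgebra ℝ V) : a * b = b * involute a := by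
  induction a using CliffordAlgebra.left_induction with
  | algebraMap r => rw [Algebra.commutes, AlgHom.commutes]
  | add x y hx hy => rw [map_add, mul_add, add_mul, hx, hy]
  | ι_mul x v hx =>
    have := ι_mul_eq_involute_mul v b
    rw [hb, neg_mul] at this
    rw [mul_assoc, hx, map_mul, involute_ι, ← mul_assoc, ← mul_assoc, mul_neg]
    exact congrArg (· * involute x) this

theorem involute_contractLeft (d : Module.Dual ℝ V) (a : ExteriorAlgebra ℝ V) :
    involute (contractLeft d a) = -contractLeft d (involute a) := by
  induction a using CliffordAlgebra.left_induction with
  | algebraMap r => simp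
  | add x y hx hy => rw [map_add, map_add, hx, hy, map_add, map_add, neg_add]
  | ι_mul x v hx =>
    rw [contractLeft_ι_mul, map_sub, map_mul, map_mul, hx, map_smul, involute_ι,
      neg_mul (ι 0 v) (involute x), map_neg (contractLeft d), contractLeft_ι_mul, neg_mul_neg]
    abel

end Gr

/-! ### The superalgebra of functions: pure tensors, parity and supercommutativity. -/

variable {n m : ℕ} {W : Opens (E n)}

namespace SF

@[elab_as_elim]
theorem induction_on {P : SF n m W → Prop} (f : SF n m W) (tmul : ∀ g η, P (tmul g η))
    (add : ∀ f g, P f → P g → P (f + g)) : P f := by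
  refine TensorProduct.induction_on (motive := P) f ?_ tmul add
  have := tmul 0 0
  rwa [show SF.tmul (0 : Smooth W) (0 : Gr m) = 0 from TensorProduct.zero_tmul _ _] at this

theorem tmul_mul_tmul (f g : Smooth W) (η ζ : Gr m) :
    tmul f η * tmul g ζ = tmul (f * g) (η * ζ) :=
  Algebra.TensorProduct.tmul_mul_tmul f g η ζ

theorem tmul_add (f : Smooth W) (η ζ : Gr m) : tmul f (η + ζ) = tmul f η + tmul f ζ :=
  TensorProduct.tmul_add _ _ _

theorem add_tmul (f g : Smooth W) (η : Gr m) : tmul (f + g) η = tmul f η + tmul g η :=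
  TensorProduct.add_tmul _ _ _

theorem sub_tmul (f g : Smooth W) (η : Gr m) : tmul (f - g) η = tmul f η - tmul g η :=
  TensorProduct.sub_tmul _ _ _

theorem smul_tmul (c : ℝ) (f : Smooth W) (η : Gr m) : tmul (c • f) η = c • tmul f η :=
  (TensorProduct.smul_tmul' c f η).symm

theorem tmul_smul (c : ℝ) (f : Smooth W) (η : Gr m) : tmul f (c • η) = c • tmul f η :=
  TensorProduct.tmul_smul c f η

theorem tmul_zero (f : Smooth W) : tmul f (0 : Gr m) = 0 := TensorProduct.tmul_zero _ _

theorem zero_tmul (η : Gr m) : tmul (0 : Smooth W) η = 0 := TensorProduct.zero_tmul _ _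

theorem one_def : (1 : SF n m W) = tmul 1 1 := rfl

theorem algebraMap_def (c : ℝ) : algebraMap ℝ (SF n m W) c = tmul (algebraMap ℝ _ c) 1 := rfl

theorem tmul_eq_mul (f : Smooth W) (η : Gr m) : tmul f η = tmul f 1 * tmul 1 η := by
  rw [tmul_mul_tmul, mul_one, one_mul]

/-- The grading involution `f ↦ (-1)^{f̃} f`. -/
def eps : SF n m W →ₐ[ℝ] SF n m W :=
  (SF.equiv n m W).symm.toAlgHom.comp
    ((Algebra.TensorProduct.map (AlgHom.id ℝ (Smooth W)) CliffordAlgebra.involute).comp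
      (SF.equiv n m W).toAlgHom)

theorem eps_tmul (f : Smooth W) (η : Gr m) :
    eps (tmul f η) = tmul f (CliffordAlgebra.involute η) := rfl

theorem res_tmul {W' : Opens (E n)} (h : W' ≤ W) (f : Smooth W) (η : Gr m) :
    res h (tmul f η) = tmul (Smooth.res h f) η := rfl

theorem body_tmul (f : Smooth W) (η : Gr m) :
    body (tmul f η) = ExteriorAlgebra.algebraMapInv η • f :=
  rfl

theorem pd_inl_tmul (i : Fin n) (f : Smooth W) (η : Gr m) :
    pd (Sum.inl i) (tmul f η) = tmul (Smooth.pderiv i f) η := rfl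

theorem pd_inr_tmul (j : Fin m) (f : Smooth W) (η : Gr m) :
    pd (Sum.inr j) (tmul f η) = tmul f (CliffordAlgebra.contractLeft
      (Q := (0 : QuadraticForm ℝ (Fin m → ℝ))) (LinearMap.proj j) η) := rfl

end SF

theorem sgn_smul_involute_of_mem_evenOdd {V : Type*} [AddCommGroup V] [Module ℝ V] {p : ZMod 2}
    {η : ExteriorAlgebra ℝ V} (h : η ∈ CliffordAlgebra.evenOdd (0 : QuadraticForm ℝ V) p) :
    CliffordAlgebra.involute η = sgn p • η := by
  rcases zmod2_cases p with rfl | rfl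
  · simpa using CliffordAlgebra.involute_eq_of_mem_even h
  · simpa using CliffordAlgebra.involute_eq_of_mem_odd h

theorem tmul_mem_parity {p : ZMod 2} (f : Smooth W) {η : Gr m}
    (h : η ∈ CliffordAlgebra.evenOdd (0 : QuadraticForm ℝ (Fin m → ℝ)) p) :
    SF.tmul f η ∈ parity n m W p :=
  ⟨f ⊗ₜ ⟨η, h⟩, rfl⟩

-- A homogeneous function is by definition in the image of `C^∞(W) ⊗ Λ_p`, so tensor induction there
-- uses only pure tensors with a homogeneous Grassmann factor.
@[elab_as_elim]
theorem parity_induction {p : ZMod 2} {P : (f : SF n m W) → f ∈ parity n m W p → Prop}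
    (tmul : ∀ (g : Smooth W) (η : Gr m)
      (h : η ∈ CliffordAlgebra.evenOdd (0 : QuadraticForm ℝ (Fin m → ℝ)) p),
      P (SF.tmul g η) (tmul_mem_parity g h))
    (add : ∀ f g hf hg, P f hf → P g hg → P (f + g) (add_mem hf hg)) (f : SF n m W)
    (hf : f ∈ parity n m W p) : P f hf := by
  have key : ∀ y (h : _ ∈ parity n m W p), P ((SF.equiv n m W).symm ((LinearMap.lTensor (Smooth W)
      (CliffordAlgebra.evenOdd (0 : QuadraticForm ℝ (Fin m → ℝ)) p).subtype) y)) h := by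
    intro y
    induction y with
    | zero =>
      intro _
      have := tmul 0 0 (Submodule.zero_mem _)
      simp only [SF.tmul_zero] at this
      simp only [map_zero]
      exact this
    | add a b ha hb =>
      intro _
      simp only [map_add]
      exact add _ _ ⟨a, rfl⟩ ⟨b, rfl⟩ (ha _) (hb _)
    | tmul g η => exact fun _ => tmul g η η.2
  have hf' := hf
  obtain ⟨y, hy⟩ := hf'
  have hy' : f = (SF.equiv n m W).symm ((LinearMap.lTensor (Smooth W)
      (CliffordAlgebra.evenOdd (0 : QuadraticForm ℝ (Fin m → ℝ)) p).subtype) y) := hy.symm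
  subst hy'
  exact key y hf

theorem eps_of_mem_parity {p : ZMod 2} {f : SF n m W} (hf : f ∈ parity n m W p) :
    SF.eps f = sgn p • f := by
  induction f, hf using parity_induction with
  | tmul g η hη => rw [SF.eps_tmul, sgn_smul_involute_of_mem_evenOdd hη, SF.tmul_smul]
  | add f g _ _ hf hg => rw [map_add, smul_add, hf, hg]

theorem exists_add_parity (f : SF n m W) :
    ∃ f₀ ∈ parity n m W 0, ∃ f₁ ∈ parity n m W 1, f = f₀ + f₁ := by
  induction f using SF.induction_on with
  | tmul g η =>
    have h : η ∈ CliffordAlgebra.evenOdd (0 : QuadraticForm ℝ (Fin m → ℝ)) 0 ⊔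
        CliffordAlgebra.evenOdd (0 : QuadraticForm ℝ (Fin m → ℝ)) 1 := by
      rw [(CliffordAlgebra.evenOdd_isCompl (0 : QuadraticForm ℝ (Fin m → ℝ))).sup_eq_top]
      trivial
    obtain ⟨a, ha, b, hb, rfl⟩ := Submodule.mem_sup.1 h
    exact ⟨_, tmul_mem_parity g ha, _, tmul_mem_parity g hb, SF.tmul_add _ _ _⟩
  | add f g hf hg =>
    obtain ⟨f₀, h0, f₁, h1, rfl⟩ := hf
    obtain ⟨g₀, k0, g₁, k1, rfl⟩ := hg
    exact ⟨_, add_mem h0 k0, _, add_mem h1 k1, by abel⟩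

/-- Split `f` into its even and odd parts: over `ℝ` the two eigenvalues of the grading involution
are distinct. Parity statements thereby become sign computations with an algebra homomorphism. -/
theorem mem_parity_iff {p : ZMod 2} {f : SF n m W} :
    f ∈ parity n m W p ↔ SF.eps f = sgn p • f := by
  refine ⟨eps_of_mem_parity, fun h => ?_⟩
  obtain ⟨f₀, h0, f₁, h1, rfl⟩ := exists_add_parity f
  rw [map_add, eps_of_mem_parity h0, eps_of_mem_parity h1] at h
  rcases zmod2_cases p with rfl | rfl
  · simp only [sgn_zero, sgn_one, one_smul, neg_smul] at h
    have : f₁ = 0 := by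
      rw [add_right_inj, neg_eq_iff_add_eq_zero, ← two_smul ℝ] at h
      simpa using h
    rw [this, add_zero]
    exact h0
  · simp only [sgn_zero, sgn_one, one_smul, neg_smul, neg_add] at h
    have : f₀ = 0 := by
      rw [add_left_inj, eq_neg_iff_add_eq_zero, ← two_smul ℝ] at h
      simpa using h
    rw [this, zero_add]
    exact h1

theorem one_mem_parity : (1 : SF n m W) ∈ parity n m W 0 := by
  simp [mem_parity_iff]

theorem mul_mem_parity {p q : ZMod 2} {f g : SF n m W} (hf : f ∈ parity n m W p)
    (hg : g ∈ parity n m W q) : f * g ∈ parity n m W (p + q) := by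
  rw [mem_parity_iff] at *
  rw [map_mul, hf, hg, smul_mul_smul_comm, sgn_add]

theorem mul_comm_of_mem_parity_zero {g : SF n m W} (hg : g ∈ parity n m W 0) (f : SF n m W) :
    f * g = g * f := by
  induction g, hg using parity_induction with
  | add a b _ _ ha hb => rw [mul_add, add_mul, ha, hb]
  | tmul g η hη =>
    induction f using SF.induction_on with
    | tmul h ζ =>
      rw [SF.tmul_mul_tmul, SF.tmul_mul_tmul, mul_comm h g, mul_comm_of_involute_eq
        (by simpa using sgn_smul_involute_of_mem_evenOdd hη)]
    | add f g hf hg => rw [add_mul, mul_add, hf, hg]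

theorem mul_comm_of_mem_parity_one {g : SF n m W} (hg : g ∈ parity n m W 1) (f : SF n m W) :
    f * g = g * SF.eps f := by
  induction g, hg using parity_induction with
  | add a b _ _ ha hb => rw [mul_add, add_mul, ha, hb]
  | tmul g η hη =>
    induction f using SF.induction_on with
    | tmul h ζ =>
      rw [SF.eps_tmul, SF.tmul_mul_tmul, SF.tmul_mul_tmul, mul_comm h g,
        mul_comm_of_involute_eq_neg (by simpa using sgn_smul_involute_of_mem_evenOdd hη)]
    | add f g hf hg => rw [add_mul, map_add, mul_add, hf, hg]

theorem supercomm {p q : ZMod 2} {f g : SF n m W} (hf : f ∈ parity n m W p)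
    (hg : g ∈ parity n m W q) : f * g = sgn (p * q) • (g * f) := by
  rcases zmod2_cases q with rfl | rfl
  · simpa using mul_comm_of_mem_parity_zero hg f
  · rw [mul_comm_of_mem_parity_one hg, eps_of_mem_parity hf, mul_one, mul_smul_comm]

/-! ### Derivatives -/

theorem coord_mem_parity (a : Idx n m) : coord n m W a ∈ parity n m W (par a) := by
  rcases a with i | j
  · exact tmul_mem_parity _ (CliffordAlgebra.one_le_evenOdd_zero _ (Submodule.one_le.1 le_rfl))
  · exact tmul_mem_parity _ (CliffordAlgebra.ι_mem_evenOdd_one _ _)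

theorem eps_pd (a : Idx n m) (f : SF n m W) :
    SF.eps (pd a f) = sgn (par a) • pd a (SF.eps f) := by
  induction f using SF.induction_on with
  | add f g hf hg => simp only [map_add, smul_add, hf, hg]
  | tmul f η =>
    rcases a with i | j
    · simp [SF.pd_inl_tmul, SF.eps_tmul, par]
    · rw [SF.pd_inr_tmul, SF.eps_tmul, SF.eps_tmul, SF.pd_inr_tmul, ← SF.tmul_smul,
        involute_contractLeft]
      simp [par]

theorem pd_mem_parity (a : Idx n m) {p : ZMod 2} {f : SF n m W} (hf : f ∈ parity n m W p) :
    pd a f ∈ parity n m W (par a + p) := by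
  rw [mem_parity_iff] at *
  rw [eps_pd, hf, map_smul, sgn_add, mul_smul]

theorem pd_mul {a : Idx n m} {p : ZMod 2} {f : SF n m W} (hf : f ∈ parity n m W p)
    (g : SF n m W) : pd a (f * g) = pd a f * g + sgn (par a * p) • (f * pd a g) := by
  induction f, hf using parity_induction with
  | add f f' _ _ hf hf' => simp only [map_add, smul_add, hf, hf', add_mul]; abel
  | tmul f η hη =>
    induction g using SF.induction_on with
    | add f g hf hg => simp only [map_add, smul_add, hf, hg, mul_add]; abel
    | tmul g ζ =>
      rw [SF.tmul_mul_tmul]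
      rcases a with i | j
      · simp only [SF.pd_inl_tmul, SF.tmul_mul_tmul, Smooth.pderiv_mul, SF.add_tmul, par,
          Sum.elim_inl, zero_mul, sgn_zero, one_smul]
      · simp only [SF.pd_inr_tmul, SF.tmul_mul_tmul, contractLeft_mul, SF.tmul_add, par,
          Sum.elim_inr, one_mul, sgn_smul_involute_of_mem_evenOdd hη, smul_mul_assoc,
          SF.tmul_smul]

theorem pd_comm (a b : Idx n m) (f : SF n m W) :
    pd a (pd b f) = sgn (par a * par b) • pd b (pd a f) := by
  induction f using SF.induction_on with
  | add f g hf hg => simp only [map_add, smul_add, hf, hg]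
  | tmul f η =>
    rcases a with i | i <;> rcases b with j | j <;>
      simp only [SF.pd_inl_tmul, SF.pd_inr_tmul, par, Sum.elim_inl, Sum.elim_inr, mul_zero,
        mul_one, sgn_zero, sgn_one, one_smul, neg_smul]
    · rw [Smooth.pderiv_comm]
    · rw [CliffordAlgebra.contractLeft_comm]
      exact (TensorProduct.tmul_neg _ _)

theorem pd_one (a : Idx n m) : pd a (1 : SF n m W) = 0 := by
  have h := pd_mul (a := a) (one_mem_parity (n := n) (m := m) (W := W)) 1
  simpa using h

theorem pd_coord (a b : Idx n m) : pd a (coord n m W b) = if a = b then 1 else 0 := by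
  rcases a with i | i <;> rcases b with j | j <;> simp only [coord, Sum.elim_inl, Sum.elim_inr]
  · rw [SF.pd_inl_tmul, Smooth.pderiv_coord]
    by_cases h : i = j
    · simp [h, SF.one_def]
    · simp [h, SF.zero_tmul]
  · rw [SF.pd_inl_tmul, Smooth.pderiv_one, SF.zero_tmul]
    simp
  · rw [SF.pd_inr_tmul, CliffordAlgebra.contractLeft_one, SF.tmul_zero]
    simp
  · rw [SF.pd_inr_tmul]
    erw [CliffordAlgebra.contractLeft_ι]
    by_cases h : i = j
    · subst h
      simp [SF.one_def]
    · simp [h, SF.tmul_zero]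

theorem pd_res {W' : Opens (E n)} (h : W' ≤ W) (a : Idx n m) (f : SF n m W) :
    pd a (SF.res h f) = SF.res h (pd a f) := by
  induction f using SF.induction_on with
  | add f g hf hg => simp only [map_add, hf, hg]
  | tmul f η =>
    rcases a with i | i
    · simp only [SF.pd_inl_tmul, SF.res_tmul, Smooth.pderiv_res]
    · simp only [SF.pd_inr_tmul, SF.res_tmul]

theorem eps_res {W' : Opens (E n)} (h : W' ≤ W) (f : SF n m W) :
    SF.eps (SF.res h f) = SF.res h (SF.eps f) := by
  induction f using SF.induction_on with
  | add f g hf hg => simp only [map_add, hf, hg]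
  | tmul f η => rfl

theorem res_mem_parity {W' : Opens (E n)} (h : W' ≤ W) {p : ZMod 2} {f : SF n m W}
    (hf : f ∈ parity n m W p) : SF.res h f ∈ parity n m W' p := by
  rw [mem_parity_iff] at *
  rw [eps_res, hf, map_smul]

theorem res_coord {W' : Opens (E n)} (h : W' ≤ W) (a : Idx n m) :
    SF.res h (coord n m W a) = coord n m W' a := by
  rcases a with i | i
  · rfl
  · rw [coord, coord, Sum.elim_inr, Sum.elim_inr, SF.res_tmul, map_one]

theorem SF.res_res {W' W'' : Opens (E n)} (h : W' ≤ W) (h' : W'' ≤ W') (f : SF n m W) :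
    SF.res h' (SF.res h f) = SF.res (h'.trans h) f := by
  induction f using SF.induction_on with
  | add f g hf hg => simp only [map_add, hf, hg]
  | tmul f η => rfl

/-! ### Values at points -/

/-- The value of a smooth function at a point. -/
def Smooth.eval (x : W) : Smooth W →ₐ[ℝ] ℝ :=
  (Pi.evalAlgHom ℝ (fun _ : W => ℝ) x).comp (Smooth W).val

/-- The value of a function on a superdomain at a point of the underlying domain. -/
def SF.eval (x : W) : SF n m W →ₐ[ℝ] Gr m :=
  (Algebra.TensorProduct.lid ℝ (Gr m)).toAlgHom.comp
    ((Algebra.TensorProduct.map (Smooth.eval x) (AlgHom.id ℝ (Gr m))).comp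
      (SF.equiv n m W).toAlgHom)

theorem SF.eval_tmul (x : W) (f : Smooth W) (η : Gr m) :
    SF.eval x (SF.tmul f η) = f.1 x • η := rfl

theorem SF.eval_res {W' : Opens (E n)} (h : W' ≤ W) (x : W') (f : SF n m W) :
    SF.eval x (SF.res h f) = SF.eval ⟨x, h x.2⟩ f := by
  induction f using SF.induction_on with
  | add f g hf hg => simp only [map_add, hf, hg]
  | tmul f η => rfl

-- A basis of the Grassmann algebra identifies an element of the tensor product with a family of
-- ordinary smooth functions, and these are determined by their values.
open scoped Classical in
theorem SF.eq_zero_of_eval {f : SF n m W} (h : ∀ x : W, SF.eval x f = 0) : f = 0 := by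
  let b := Module.Basis.ofVectorSpace ℝ (Gr m)
  let e : SF n m W ≃ₗ[ℝ] _ := (SF.equiv n m W).toLinearEquiv ≪≫ₗ
    TensorProduct.equivFinsuppOfBasisRight (M := Smooth W) b
  have key : ∀ (f : SF n m W) (x : W) i, (e f i).1 x = b.repr (SF.eval x f) i := by
    intro f x i
    induction f using SF.induction_on with
    | add f g hf hg =>
      simp only [map_add, Finsupp.add_apply, ← hf, ← hg]
      rfl
    | tmul f η =>
      have : e (SF.tmul f η) i = b.repr η i • f :=
        TensorProduct.equivFinsuppOfBasisRight_apply_tmul_apply b f η i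
      rw [this, SF.eval_tmul, map_smul, Finsupp.smul_apply, smul_eq_mul, mul_comm]
      rfl
  rw [← e.map_eq_zero_iff]
  ext i x
  rw [key, h]
  simp

theorem SF.ext_eval {f g : SF n m W} (h : ∀ x : W, SF.eval x f = SF.eval x g) : f = g := by
  rw [← sub_eq_zero]
  exact SF.eq_zero_of_eval fun x => by rw [map_sub, h, sub_self]

theorem SF.ext_res {f g : SF n m W}
    (h : ∀ x ∈ W, ∃ (U : Opens (E n)) (hU : U ≤ W), x ∈ U ∧ SF.res hU f = SF.res hU g) :
    f = g := by
  refine SF.ext_eval fun x => ?_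
  obtain ⟨U, hU, hx, hfg⟩ := h x x.2
  have := congrArg (SF.eval ⟨x, hx⟩) hfg
  rwa [SF.eval_res, SF.eval_res] at this

/-! ### Superderivations of the sheaf of functions -/

/-- A sheaf of superderivations of parity `d` which vanishes on the coordinates is zero. -/
theorem superderivation_eq_zero {D : Opens (E n)}
    (K : ∀ V, V ≤ D → SF n m V →ₗ[ℝ] SF n m V) (d : ZMod 2)
    (hder : ∀ V hV f p, f ∈ parity n m V p → ∀ g,
      K V hV (f * g) = K V hV f * g + sgn (d * p) • (f * K V hV g))
    (hres : ∀ V hV V' (h : V' ≤ V) f, SF.res h (K V hV f) = K V' (h.trans hV) (SF.res h f))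
    (hcoord : ∀ V hV a, K V hV (coord n m V a) = 0) (V : Opens (E n)) (hV : V ≤ D)
    (f : SF n m V) : K V hV f = 0 := by
  have hone : ∀ V hV, K V hV 1 = 0 := fun V hV => by
    have := hder V hV 1 0 one_mem_parity 1
    simpa using this
  have hconst : ∀ V hV (c : ℝ), K V hV (algebraMap ℝ _ c) = 0 := fun V hV c => by
    rw [Algebra.algebraMap_eq_smul_one, map_smul, hone, smul_zero]
  -- The Grassmann variables are generated by the odd coordinates, so Leibniz suffices.
  have hodd : ∀ V hV (η : Gr m), K V hV (SF.tmul 1 η) = 0 := by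
    intro V hV η
    have hι : ∀ v : Fin m → ℝ, K V hV (SF.tmul 1 (ExteriorAlgebra.ι ℝ v)) = 0 := by
      intro v
      rw [pi_eq_sum_univ' v]
      have : (SF.tmul 1 (ExteriorAlgebra.ι ℝ (∑ j, v j • (Pi.single j 1 : Fin m → ℝ))) :
          SF n m V) = ∑ j, v j • coord n m V (Sum.inr j) := by
        rw [map_sum]
        refine (TensorProduct.tmul_sum _ _ _).trans (Finset.sum_congr rfl fun j _ => ?_)
        rw [map_smul]
        exact SF.tmul_smul _ _ _
      rw [this, map_sum]
      exact Finset.sum_eq_zero fun j _ => by rw [map_smul, hcoord, smul_zero]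
    induction η using CliffordAlgebra.left_induction with
    | algebraMap r =>
      rw [Algebra.algebraMap_eq_smul_one, SF.tmul_smul, map_smul, ← SF.one_def, hone, smul_zero]
    | add x y hx hy => rw [SF.tmul_add, map_add, hx, hy, add_zero]
    | ι_mul x v hx =>
      have h := hder V hV (SF.tmul 1 (ExteriorAlgebra.ι ℝ v)) 1
        (tmul_mem_parity _ (CliffordAlgebra.ι_mem_evenOdd_one _ _)) (SF.tmul 1 x)
      rw [hι, hx, SF.tmul_mul_tmul, zero_mul, mul_zero, smul_zero, add_zero, one_mul] at h
      exact h
  have heven : ∀ V hV (g : Smooth V), K V hV (SF.tmul g 1) = 0 := by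
    intro V hV g
    refine SF.eq_zero_of_eval fun x => ?_
    -- Near `x`, `g` is a constant plus a sum of terms `(xⁱ - xⁱ(x)) hᵢ`. Since `K` kills constants
    -- and coordinates, only `(xⁱ - xⁱ(x)) K hᵢ` remains, and it vanishes at `x`.
    obtain ⟨U, hU, hxU, h, hg⟩ := Smooth.exists_hadamard g x
    rw [← SF.eval_res hU ⟨x, hxU⟩, hres, SF.res_tmul, hg]
    have : (SF.tmul (algebraMap ℝ _ (g.1 x) +
        ∑ i, (Smooth.coord U i - algebraMap ℝ _ ((x : E n) i)) * h i) 1 : SF n m U) =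
        algebraMap ℝ _ (g.1 x) +
        ∑ i, (coord n m U (Sum.inl i) - algebraMap ℝ _ ((x : E n) i)) * SF.tmul (h i) 1 := by
      rw [SF.add_tmul]
      congr 1
      refine (TensorProduct.sum_tmul _ _ _).trans (Finset.sum_congr rfl fun i _ => ?_)
      rw [SF.algebraMap_def, coord, Sum.elim_inl, ← SF.sub_tmul, SF.tmul_mul_tmul, mul_one]
      rfl
    rw [this, map_add, hconst, zero_add, map_sum, map_sum]
    refine Finset.sum_eq_zero fun i _ => ?_
    rw [hder _ _ _ 0 (sub_mem (coord_mem_parity (Sum.inl i)) (by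
      rw [Algebra.algebraMap_eq_smul_one]; exact Submodule.smul_mem _ _ one_mem_parity)),
      map_sub, hcoord, hconst, sub_zero, zero_mul, zero_add, map_smul, map_mul]
    have : SF.eval (⟨x, hxU⟩ : U) (coord n m U (Sum.inl i) - algebraMap ℝ _ ((x : E n) i)) = 0 := by
      rw [map_sub, AlgHom.commutes, coord, Sum.elim_inl, SF.eval_tmul, sub_eq_zero,
        Algebra.algebraMap_eq_smul_one]
      rfl
    rw [this, zero_mul, smul_zero]
  induction f using SF.induction_on with
  | add f g hf hg => rw [map_add, hf, hg, add_zero]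
  | tmul g η =>
    have h := hder V hV (SF.tmul g 1) 0
      (tmul_mem_parity _ (CliffordAlgebra.one_le_evenOdd_zero _ (Submodule.one_le.1 le_rfl)))
      (SF.tmul 1 η)
    rw [heven, hodd, zero_mul, zero_add, ← SF.tmul_eq_mul] at h
    rw [h, mul_zero (SF.tmul g 1), smul_zero]

/-! ### Densities -/

namespace Dens

/-- The coefficient of `(Dx)^w`. -/
def coeffL (w : ℝ) : Dens n m W →ₗ[ℝ] SF n m W where
  toFun ψ := ψ.coeff w
  map_add' _ _ := rfl
  map_smul' _ _ := rfl

/-- The embedding `f ↦ f (Dx)^w`. -/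
def densL (w : ℝ) : SF n m W →ₗ[ℝ] Dens n m W where
  toFun f := dens w f
  map_add' _ _ := AddMonoidAlgebra.single_add ..
  map_smul' _ _ := (AddMonoidAlgebra.smul_single ..).symm

theorem dens_add (w : ℝ) (f g : SF n m W) : dens w (f + g) = dens w f + dens w g :=
  (densL w).map_add f g

theorem dens_smul (w c : ℝ) (f : SF n m W) : dens w (c • f) = c • dens w f :=
  (densL w).map_smul c f

theorem dens_sum {ι : Type*} (w : ℝ) (s : Finset ι) (f : ι → SF n m W) :
    dens w (∑ i ∈ s, f i) = ∑ i ∈ s, dens w (f i) :=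
  map_sum (densL w) f s

theorem dens_zero (w : ℝ) : dens w (0 : SF n m W) = 0 := (densL w).map_zero

theorem dens_mul (w v : ℝ) (f g : SF n m W) : dens w f * dens v g = dens (w + v) (f * g) :=
  AddMonoidAlgebra.single_mul_single ..

theorem dens_injective (w : ℝ) : Function.Injective (dens w : SF n m W → Dens n m W) :=
  fun f g h => by
    have := congrArg (fun ψ => ψ.coeff w) h
    simpa using this

theorem HasParity.add {p : ZMod 2} {ψ χ : Dens n m W} (hψ : ψ.HasParity p) (hχ : χ.HasParity p) :
    (ψ + χ).HasParity p := fun w => add_mem (hψ w) (hχ w)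

theorem HasParity.dens {p : ZMod 2} {f : SF n m W} (hf : f ∈ parity n m W p) (w : ℝ) :
    (dens w f).HasParity p := fun v => by
  rw [AddMonoidAlgebra.coeff_single, Finsupp.single_apply]
  split_ifs
  exacts [hf, zero_mem _]

theorem HasParity.zero {p : ZMod 2} : (0 : Dens n m W).HasParity p := fun _ => zero_mem _

@[elab_as_elim]
theorem parity_induction {p : ZMod 2} {P : (ψ : Dens n m W) → ψ.HasParity p → Prop}
    (zero : P 0 HasParity.zero)
    (dens : ∀ w f (hf : f ∈ parity n m W p), P (dens w f) (HasParity.dens hf w))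
    (add : ∀ ψ χ hψ hχ, P ψ hψ → P χ hχ → P (ψ + χ) (hψ.add hχ)) (ψ : Dens n m W)
    (hψ : ψ.HasParity p) : P ψ hψ := by
  have key : ∃ h, P ψ h := by
    rw [← AddMonoidAlgebra.sum_coeff_single ψ]
    exact Finset.sum_induction _ (fun ψ => ∃ h, P ψ h)
      (fun _ _ ⟨_, h⟩ ⟨_, h'⟩ => ⟨_, add _ _ _ _ h h'⟩) ⟨_, zero⟩ fun w _ => ⟨_, dens w _ (hψ w)⟩
  exact key.2

theorem supercomm {p q : ZMod 2} {ψ χ : Dens n m W} (hψ : ψ.HasParity p)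
    (hχ : χ.HasParity q) : ψ * χ = sgn (p * q) • (χ * ψ) := by
  induction ψ, hψ using parity_induction with
  | zero => simp
  | add a b _ _ ha hb => rw [add_mul, ha, hb, mul_add, smul_add]
  | dens w f hf =>
    induction χ, hχ using parity_induction with
    | zero => simp
    | add a b _ _ ha hb => rw [mul_add, ha, hb, add_mul, smul_add]
    | dens v g hg =>
      rw [dens_mul, dens_mul, OddLongBracket.supercomm hf hg, dens_smul, add_comm]

theorem res_dens {W' : Opens (E n)} (h : W' ≤ W) (w : ℝ) (f : SF n m W) :
    Dens.res h (dens w f) = dens w (SF.res h f) :=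
  AddMonoidAlgebra.mapAlgHom_single ..

theorem coeff_res {W' : Opens (E n)} (h : W' ≤ W) (w : ℝ) (ψ : Dens n m W) :
    (Dens.res h ψ).coeff w = SF.res h (ψ.coeff w) :=
  AddMonoidAlgebra.coeff_mapAlgHom ..

theorem HasParity.res {W' : Opens (E n)} (h : W' ≤ W) {p : ZMod 2} {ψ : Dens n m W}
    (hψ : ψ.HasParity p) : (Dens.res h ψ).HasParity p := fun w => by
  rw [coeff_res]
  exact res_mem_parity h (hψ w)

theorem res_res {W' W'' : Opens (E n)} (h : W' ≤ W) (h' : W'' ≤ W') (ψ : Dens n m W) :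
    Dens.res h' (Dens.res h ψ) = Dens.res (h'.trans h) ψ := by
  ext w
  rw [coeff_res, coeff_res, coeff_res, SF.res_res]

theorem ext_res {ψ χ : Dens n m W}
    (h : ∀ x ∈ W, ∃ (U : Opens (E n)) (hU : U ≤ W), x ∈ U ∧ Dens.res hU ψ = Dens.res hU χ) :
    ψ = χ := by
  ext w
  refine SF.ext_res fun x hx => ?_
  obtain ⟨U, hU, hxU, he⟩ := h x hx
  refine ⟨U, hU, hxU, ?_⟩
  rw [← coeff_res, he, coeff_res]

theorem coeff_dens_zero_mul (f : SF n m W) (ψ : Dens n m W) (w : ℝ) :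
    (dens 0 f * ψ).coeff w = f * ψ.coeff w :=
  AddMonoidAlgebra.coeff_single_zero_mul ..

theorem coeff_mul_dens_zero (f : SF n m W) (ψ : Dens n m W) (w : ℝ) :
    (ψ * dens 0 f).coeff w = ψ.coeff w * f :=
  AddMonoidAlgebra.coeff_mul_single_zero ..

theorem dens_eq_mul (w : ℝ) (f : SF n m W) : dens w f = dens 0 f * dens w 1 := by
  rw [dens_mul, zero_add, mul_one]

end Dens

/-- A sheaf of superderivations of parity `d` from functions to densities which vanishes on the
coordinates is zero. -/
theorem superderivation_dens_eq_zero {D : Opens (E n)}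
    (K : ∀ V, V ≤ D → Dens n m V →ₗ[ℝ] Dens n m V) (d : ZMod 2)
    (hder : ∀ V hV (ψ : Dens n m V) p, ψ.HasParity p → ∀ χ,
      K V hV (ψ * χ) = K V hV ψ * χ + sgn (d * p) • (ψ * K V hV χ))
    (hres : ∀ V hV V' (h : V' ≤ V) ψ, Dens.res h (K V hV ψ) = K V' (h.trans hV) (Dens.res h ψ))
    (hcoord : ∀ V hV a, K V hV (dens 0 (coord n m V a)) = 0) (V : Opens (E n)) (hV : V ≤ D)
    (f : SF n m V) : K V hV (dens 0 f) = 0 := by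
  ext w
  refine superderivation_eq_zero (fun V hV => Dens.coeffL w ∘ₗ K V hV ∘ₗ Dens.densL 0) d
    ?_ ?_ ?_ V hV f
  · intro V hV f p hf g
    change (K V hV (dens 0 (f * g))).coeff w = (K V hV (dens 0 f)).coeff w * g +
      sgn (d * p) • (f * (K V hV (dens 0 g)).coeff w)
    rw [← Dens.coeff_mul_dens_zero, ← Dens.coeff_dens_zero_mul]
    have := hder V hV (dens 0 f) p (Dens.HasParity.dens hf 0) (dens 0 g)
    rw [Dens.dens_mul, add_zero] at this
    rw [this]
    rfl
  · intro V hV V' h f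
    change SF.res h ((K V hV (dens 0 f)).coeff w) = (K V' _ (dens 0 (SF.res h f))).coeff w
    rw [← Dens.coeff_res, hres, Dens.res_dens]
  · intro V hV a
    change (K V hV (dens 0 _)).coeff w = 0
    rw [hcoord]
    rfl

/-! ### Brackets on a superdomain -/

/-- An odd bracket of weight `0` in the sheaf of densities on a superdomain. -/
structure BracketOn (n m : ℕ) (D : Opens (E n)) where
  br : ∀ W, W ≤ D → Dens n m W →ₗ[ℝ] Dens n m W →ₗ[ℝ] Dens n m W
  isBracket : ∀ W hW, IsOddBracket (br W hW)
  res : ∀ W hW W' (h : W' ≤ W) ψ χ,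
    Dens.res h (br W hW ψ χ) = br W' (h.trans hW) (Dens.res h ψ) (Dens.res h χ)

/-- The bracket in a chart. -/
def LongBracket.on {M : Type*} [TopologicalSpace M] {X : Supermanifold n m M} (B : LongBracket X)
    (i : X.I) : BracketOn n m (X.dom i) where
  br := B.br i
  isBracket := B.isBracket i
  res := B.res i

namespace BracketOn
variable {D : Opens (E n)} (B : BracketOn n m D) (hW : W ≤ D)

/-- The left-hand side of the Jacobi identity. -/
def jac (ψ χ φ : Dens n m W) (p q r : ZMod 2) : Dens n m W :=
  sgn (p * r) • B.br W hW (B.br W hW ψ χ) φ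
      + sgn (r * q) • B.br W hW (B.br W hW φ ψ) χ
      + sgn (q * p) • B.br W hW (B.br W hW χ φ) ψ

/-- Allows each of the three arguments in turn to occupy the last slot, where the Jacobi expression
is a derivation. -/
theorem jac_cycle (ψ χ φ : Dens n m W) (p q r : ZMod 2) :
    B.jac hW φ ψ χ r p q = B.jac hW ψ χ φ p q r := by
  simp only [jac, mul_comm]
  abel

/-- The difference between the Hamiltonian derivation of `{ψ; χ}` and the commutator of the
Hamiltonian derivations of `ψ` and `χ`, for `ψ` of parity `p` and `χ` of parity `q`. -/
def defect (ψ χ : Dens n m W) (p q : ZMod 2) : Dens n m W →ₗ[ℝ] Dens n m W :=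
  B.br W hW (B.br W hW ψ χ) + sgn (p * q + q) • (B.br W hW χ ∘ₗ B.br W hW ψ)
    + sgn p • (B.br W hW ψ ∘ₗ B.br W hW χ)

variable {B hW} {ψ χ φ : Dens n m W} {p q r : ZMod 2}

theorem defect_apply (ψ χ φ : Dens n m W) (p q : ZMod 2) : B.defect hW ψ χ p q φ =
    B.br W hW (B.br W hW ψ χ) φ + sgn (p * q + q) • B.br W hW χ (B.br W hW ψ φ)
    + sgn p • B.br W hW ψ (B.br W hW χ φ) := rfl

theorem br_parity (hψ : ψ.HasParity p) (hχ : χ.HasParity q) :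
    (B.br W hW ψ χ).HasParity (p + q + 1) :=
  (B.isBracket W hW).odd _ _ _ _ hψ hχ

theorem br_symm (hψ : ψ.HasParity p) (hχ : χ.HasParity q) :
    B.br W hW ψ χ = sgn (p * q) • B.br W hW χ ψ :=
  (B.isBracket W hW).symm _ _ _ _ hψ hχ

theorem br_mul (hψ : ψ.HasParity p) (hχ : χ.HasParity q) (φ : Dens n m W) :
    B.br W hW ψ (χ * φ) = B.br W hW ψ χ * φ + sgn ((p + 1) * q) • (χ * B.br W hW ψ φ) :=
  (B.isBracket W hW).leibniz _ _ _ _ _ hψ hχ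

/-- Symmetry of the bracket rewrites the second and third terms as iterated derivations applied to
`φ`; the remaining signs are settled by the eight choices of parities. -/
theorem jac_eq (hψ : ψ.HasParity p) (hχ : χ.HasParity q) (hφ : φ.HasParity r) :
    B.jac hW ψ χ φ p q r = sgn (p * r) • B.defect hW ψ χ p q φ := by
  rw [jac, defect_apply, br_symm hφ hψ, map_smul, LinearMap.smul_apply,
    br_symm (br_parity hψ hφ) hχ, br_symm (br_parity hχ hφ) hψ]
  rcases zmod2_cases p with rfl | rfl <;> rcases zmod2_cases q with rfl | rfl <;>
    rcases zmod2_cases r with rfl | rfl <;> simp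

/-- A supercommutator of superderivations is a superderivation: the cross terms of the two
compositions cancel. -/
theorem defect_mul (hψ : ψ.HasParity p) (hχ : χ.HasParity q) (hφ : φ.HasParity r)
    (φ' : Dens n m W) : B.defect hW ψ χ p q (φ * φ') =
      B.defect hW ψ χ p q φ * φ' + sgn ((p + q) * r) • (φ * B.defect hW ψ χ p q φ') := by
  rw [defect_apply, defect_apply, defect_apply, br_mul (br_parity hψ hχ) hφ, br_mul hψ hφ,
    br_mul hχ hφ, map_add, map_add, map_smul, map_smul, br_mul hχ hφ, br_mul hψ hφ,
    br_mul hχ (br_parity hψ hφ), br_mul hψ (br_parity hχ hφ)]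
  rcases zmod2_cases p with rfl | rfl <;> rcases zmod2_cases q with rfl | rfl <;>
    rcases zmod2_cases r with rfl | rfl <;> simp [add_mul, mul_add] <;> abel

theorem one_parity (w : ℝ) : (dens w (1 : SF n m W)).HasParity 0 :=
  Dens.HasParity.dens one_mem_parity w

theorem br_pow (ψ : Dens n m W) (w : ℝ) :
    B.br W hW ψ (dens w 1) = w • (dens (w - 1) 1 * B.br W hW ψ (dens 1 1)) :=
  (B.isBracket W hW).chain ψ w

/-- Applying the chain rule twice produces a term with `w (w - 1) (Dx)^{w-2} {ψ; Dx}{χ; Dx}`. By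
supercommutativity it cancels between the two compositions, and what is left is `w (Dx)^{w-1}` times
the defect at `Dx`. -/
theorem defect_pow (hψ : ψ.HasParity p) (hχ : χ.HasParity q)
    (h : B.defect hW ψ χ p q (dens 1 1) = 0) (w : ℝ) :
    B.defect hW ψ χ p q (dens w 1) = 0 := by
  rw [defect_apply] at h ⊢
  have key : ∀ {ψ χ : Dens n m W} {p q}, ψ.HasParity p → χ.HasParity q →
      B.br W hW ψ (B.br W hW χ (dens w 1)) =
      w • (dens (w - 1) 1 * B.br W hW ψ (B.br W hW χ (dens 1 1))) +
      (w * (w - 1)) • (dens (w - 1 - 1) 1 *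
        (B.br W hW ψ (dens 1 1) * B.br W hW χ (dens 1 1))) := by
    intro ψ χ p q hψ hχ
    rw [br_pow, map_smul, br_mul hψ (one_parity _), br_pow ψ (w - 1)]
    simp only [mul_zero, sgn_zero, one_smul, smul_add, smul_smul, smul_mul_assoc, mul_assoc]
    abel
  rw [br_pow, key hψ hχ, key hχ hψ, Dens.supercomm (br_parity hχ (one_parity 1))
    (br_parity hψ (one_parity 1))]
  have h' := congrArg (fun x => w • (dens (w - 1) 1 * x)) h
  simp only [mul_zero, smul_zero, mul_add, smul_add, mul_smul_comm] at h'
  rw [← h']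
  rcases zmod2_cases p with rfl | rfl <;> rcases zmod2_cases q with rfl | rfl <;>
    simp <;> abel

theorem res_defect {W' : Opens (E n)} (h : W' ≤ W) (ψ χ φ : Dens n m W) (p q : ZMod 2) :
    Dens.res h (B.defect hW ψ χ p q φ) =
      B.defect (h.trans hW) (Dens.res h ψ) (Dens.res h χ) p q (Dens.res h φ) := by
  simp only [defect_apply, map_add, map_smul, B.res]

theorem defect_dens_zero (hψ : ψ.HasParity p) (hχ : χ.HasParity q)
    (h : ∀ a, B.defect hW ψ χ p q (dens 0 (coord n m W a)) = 0) (f : SF n m W) :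
    B.defect hW ψ χ p q (dens 0 f) = 0 := by
  -- The argument by values at points needs the derivation on every open `V ≤ W`; there `ψ` and `χ`
  -- are replaced by their restrictions.
  have := superderivation_dens_eq_zero (D := W) (fun V hV =>
    B.defect (hV.trans hW) (Dens.res hV ψ) (Dens.res hV χ) p q) (p + q)
    (fun V hV φ r hφ φ' => defect_mul (hψ.res hV) (hχ.res hV) hφ φ')
    (fun V hV V' h φ => by rw [res_defect, Dens.res_res, Dens.res_res])
    (fun V hV a => by rw [← res_coord hV, ← Dens.res_dens, ← res_defect (hW := hW), h,
      map_zero])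
    W le_rfl f
  have hid : ∀ ψ : Dens n m W, Dens.res le_rfl ψ = ψ := fun ψ => by
    ext w
    rw [Dens.coeff_res]
    refine SF.ext_eval fun x => ?_
    rw [SF.eval_res]
  simpa only [hid] using this

theorem defect_eq_zero (hψ : ψ.HasParity p) (hχ : χ.HasParity q)
    (h : ∀ a, B.defect hW ψ χ p q (dens 0 (coord n m W a)) = 0)
    (ht : B.defect hW ψ χ p q (dens 1 1) = 0) (φ : Dens n m W) :
    B.defect hW ψ χ p q φ = 0 := by
  have key : ∀ r, ∀ f ∈ parity n m W r, ∀ w, B.defect hW ψ χ p q (dens w f) = 0 := by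
    intro r f hf w
    rw [Dens.dens_eq_mul, defect_mul hψ hχ (Dens.HasParity.dens hf 0), defect_pow hψ hχ ht,
      defect_dens_zero hψ hχ h]
    simp
  induction φ using AddMonoidAlgebra.induction_linear with
  | zero => simp
  | add a b ha hb => rw [map_add, ha, hb, add_zero]
  | single w f =>
    obtain ⟨f₀, h0, f₁, h1, rfl⟩ := exists_add_parity f
    rw [AddMonoidAlgebra.single_add, map_add, key 0 f₀ h0, key 1 f₁ h1, add_zero]

variable (n m W) in
/-- The generators `xᵃ` and `Dx` of the algebra of densities. -/
def gen : Option (Idx n m) → Dens n m W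
  | some a => dens 0 (coord n m W a)
  | none => dens 1 1

/-- The parity of a generator. -/
def genPar : Option (Idx n m) → ZMod 2
  | some a => par a
  | none => 0

theorem gen_parity (g : Option (Idx n m)) : (gen n m W g).HasParity (genPar g) := by
  rcases g with _ | a
  exacts [one_parity 1, Dens.HasParity.dens (coord_mem_parity a) 0]

theorem sgn_smul_eq_zero {V : Type*} [AddCommGroup V] [Module ℝ V] {p : ZMod 2} {v : V} :
    sgn p • v = 0 ↔ v = 0 := by
  rcases zmod2_cases p with rfl | rfl <;> simp

theorem jac_eq_zero_of_gen_right (hψ : ψ.HasParity p) (hχ : χ.HasParity q)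
    (h : ∀ g, B.jac hW ψ χ (gen n m W g) p q (genPar g) = 0) (hφ : φ.HasParity r) :
    B.jac hW ψ χ φ p q r = 0 := by
  have h' : ∀ g, B.defect hW ψ χ p q (gen n m W g) = 0 := fun g => by
    have := h g
    rwa [jac_eq hψ hχ (gen_parity g), sgn_smul_eq_zero] at this
  rw [jac_eq hψ hχ hφ, defect_eq_zero hψ hχ (fun a => h' (some a)) (h' none), smul_zero]

/-- The Jacobi identity holds if it holds for the generators. -/
theorem jac_eq_zero_of_gen (h : ∀ a b c, B.jac hW (gen n m W a) (gen n m W b) (gen n m W c)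
      (genPar a) (genPar b) (genPar c) = 0)
    (hψ : ψ.HasParity p) (hχ : χ.HasParity q) (hφ : φ.HasParity r) :
    B.jac hW ψ χ φ p q r = 0 := by
  refine jac_eq_zero_of_gen_right hψ hχ (fun c => ?_) hφ
  -- Two cyclic shifts bring `ψ` to the last slot; the same is done below for `χ`.
  rw [← jac_cycle, ← jac_cycle]
  refine jac_eq_zero_of_gen_right hχ (gen_parity _) (fun b => ?_) hψ
  rw [← jac_cycle, ← jac_cycle]
  exact jac_eq_zero_of_gen_right (gen_parity _) (gen_parity _) (h c b) hχ

theorem jac_eq_zero_of_coord_right (hψ : ψ.HasParity p) (hχ : χ.HasParity q)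
    (h : ∀ a, B.jac hW ψ χ (dens 0 (coord n m W a)) p q (par a) = 0) {f : SF n m W}
    (hf : f ∈ parity n m W r) : B.jac hW ψ χ (dens 0 f) p q r = 0 := by
  have h' : ∀ a, B.defect hW ψ χ p q (dens 0 (coord n m W a)) = 0 := fun a => by
    have := h a
    rwa [jac_eq hψ hχ (Dens.HasParity.dens (coord_mem_parity a) 0), sgn_smul_eq_zero] at this
  rw [jac_eq hψ hχ (Dens.HasParity.dens hf 0), defect_dens_zero hψ hχ h', smul_zero]

/-- The Jacobi identity holds for functions if it holds for the coordinates. -/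
theorem jac_eq_zero_of_coord (h : ∀ a b c, B.jac hW (dens 0 (coord n m W a))
      (dens 0 (coord n m W b)) (dens 0 (coord n m W c)) (par a) (par b) (par c) = 0)
    {f g k : SF n m W} (hf : f ∈ parity n m W p) (hg : g ∈ parity n m W q)
    (hk : k ∈ parity n m W r) :
    B.jac hW (dens 0 f) (dens 0 g) (dens 0 k) p q r = 0 := by
  have hc := fun a => Dens.HasParity.dens (coord_mem_parity (W := W) (n := n) (m := m) a) 0
  refine jac_eq_zero_of_coord_right (.dens hf 0) (.dens hg 0) (fun c => ?_) hk
  rw [← jac_cycle, ← jac_cycle]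
  refine jac_eq_zero_of_coord_right (.dens hg 0) (hc c) (fun b => ?_) hf
  rw [← jac_cycle, ← jac_cycle]
  exact jac_eq_zero_of_coord_right (hc c) (hc b) (h c b) hg

/-! ### Coordinate expressions -/

/-- `{ψ; f} = ∑ₐ {ψ; xᵃ} ∂ₐ f`. -/
theorem br_dens_zero (hψ : ψ.HasParity p) (f : SF n m W) : B.br W hW ψ (dens 0 f) =
    ∑ a, B.br W hW ψ (dens 0 (coord n m W a)) * dens 0 (pd a f) := by
  ext w
  rw [AddMonoidAlgebra.coeff_sum, Finset.sum_apply', ← sub_eq_zero]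
  simp only [Dens.coeff_mul_dens_zero]
  have hx : ∀ V (hV : V ≤ W) a, (B.br V (hV.trans hW) (Dens.res hV ψ)
      (dens 0 (coord n m V a))).coeff w ∈ parity n m V (p + par a + 1) := fun V hV a =>
    br_parity (hψ.res hV) (Dens.HasParity.dens (coord_mem_parity a) 0) w
  -- For a fixed weight `w`, the coefficients of both sides are superderivations of `f` of parity `p
  -- + 1` that agree on the coordinates; their difference is therefore zero.
  have := superderivation_eq_zero (D := W) (fun V hV =>
    Dens.coeffL w ∘ₗ B.br V (hV.trans hW) (Dens.res hV ψ) ∘ₗ Dens.densL 0 -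
    ∑ a, LinearMap.mulLeft ℝ ((B.br V (hV.trans hW) (Dens.res hV ψ)
      (dens 0 (coord n m V a))).coeff w) ∘ₗ pd a) (p + 1) ?_ ?_ ?_ W le_rfl f
  · have hid : Dens.res le_rfl ψ = ψ := by
      ext w
      rw [Dens.coeff_res]
      refine SF.ext_eval fun x => ?_
      rw [SF.eval_res]
    simp only [hid, LinearMap.sub_apply, LinearMap.sum_apply] at this
    exact this
  · intro V hV f q hf g
    simp only [LinearMap.sub_apply, LinearMap.sum_apply]
    change (B.br V _ (Dens.res hV ψ) (dens 0 (f * g))).coeff w - ∑ a, _ * pd a (f * g) =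
      ((B.br V _ (Dens.res hV ψ) (dens 0 f)).coeff w - ∑ a, _ * pd a f) * g + sgn ((p + 1) * q) •
      (f * ((B.br V _ (Dens.res hV ψ) (dens 0 g)).coeff w - ∑ a, _ * pd a g))
    have h1 : (dens 0 (f * g) : Dens n m V) = dens 0 f * dens 0 g := by
      rw [Dens.dens_mul, add_zero]
    rw [h1, br_mul (hψ.res hV) (Dens.HasParity.dens hf 0), AddMonoidAlgebra.coeff_add,
      Finsupp.add_apply, AddMonoidAlgebra.coeff_smul, Finsupp.smul_apply,
      Dens.coeff_mul_dens_zero, Dens.coeff_dens_zero_mul, sub_mul, mul_sub, smul_sub,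
      show ∑ a, (B.br V (hV.trans hW) (Dens.res hV ψ) (dens 0 (coord n m V a))).coeff w *
        pd a (f * g) =
        (∑ a, (B.br V (hV.trans hW) (Dens.res hV ψ) (dens 0 (coord n m V a))).coeff w *
          pd a f) * g + sgn ((p + 1) * q) • (f * ∑ a, (B.br V (hV.trans hW) (Dens.res hV ψ)
          (dens 0 (coord n m V a))).coeff w * pd a g) from ?_]
    · abel
    rw [Finset.sum_mul, Finset.mul_sum, Finset.smul_sum, ← Finset.sum_add_distrib]
    refine Finset.sum_congr rfl fun a _ => ?_
    rw [pd_mul hf, mul_add, mul_assoc, mul_smul_comm, ← mul_assoc _ f, supercomm (hx V hV a) hf,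
      smul_mul_assoc, smul_smul, mul_assoc, ← sgn_add]
    congr 4
    rw [show par a * q + (p + par a + 1) * q = (p + 1) * q + (par a * q + par a * q) by ring,
      CharTwo.add_self_eq_zero, add_zero]
  · intro V hV V' h f
    simp only [LinearMap.sub_apply, LinearMap.sum_apply, map_sub, map_sum]
    congr 1
    · change SF.res h ((B.br V _ (Dens.res hV ψ) (dens 0 f)).coeff w) =
        (B.br V' _ (Dens.res _ ψ) (dens 0 (SF.res h f))).coeff w
      rw [← Dens.coeff_res, B.res, Dens.res_res, Dens.res_dens]
    · refine Finset.sum_congr rfl fun a _ => ?_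
      change SF.res h (_ * _) = _ * pd a (SF.res h f)
      rw [map_mul, ← Dens.coeff_res, B.res, Dens.res_res, Dens.res_dens, res_coord, pd_res]
  · intro V hV b
    simp only [LinearMap.sub_apply, LinearMap.sum_apply, LinearMap.comp_apply, pd_coord]
    rw [Finset.sum_eq_single b]
    · simp only [if_pos, LinearMap.mulLeft_apply, mul_one]
      exact sub_self _
    · intro a _ hab
      simp [hab]
    · simp

variable (B hW)

/-- `S^{ab}`, where `{xᵃ; xᵇ} = S^{ab}`. -/
def S (a b : Idx n m) : SF n m W :=
  (B.br W hW (dens 0 (coord n m W a)) (dens 0 (coord n m W b))).coeff 0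

/-- `γᵃ`, where `{xᵃ; Dx} = γᵃ Dx`. -/
def gamma (a : Idx n m) : SF n m W :=
  (B.br W hW (dens 0 (coord n m W a)) (dens 1 1)).coeff 1

/-- `θ`, where `{Dx; Dx} = θ (Dx)²`. -/
def theta : SF n m W := (B.br W hW (dens 1 1) (dens 1 1)).coeff 2

/-- The derivation `f ↦ {xᵃ; f}`. -/
def ham (a : Idx n m) (f : SF n m W) : SF n m W := ∑ b, B.S hW a b * pd b f

/-- The derivation `f ↦ {Dx; f} (Dx)⁻¹`. -/
def Gam (f : SF n m W) : SF n m W := ∑ a, B.gamma hW a * pd a f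

theorem br_coord_coord (a b : Idx n m) : B.br W hW (dens 0 (coord n m W a))
    (dens 0 (coord n m W b)) = dens 0 (B.S hW a b) := by
  obtain ⟨h, hh⟩ := (B.isBracket W hW).weight 0 0 (coord n m W a) (coord n m W b)
  rw [S, hh, add_zero, AddMonoidAlgebra.coeff_single, Finsupp.single_eq_same]

theorem br_coord_vol (a : Idx n m) : B.br W hW (dens 0 (coord n m W a)) (dens 1 1) =
    dens 1 (B.gamma hW a) := by
  obtain ⟨h, hh⟩ := (B.isBracket W hW).weight 0 1 (coord n m W a) 1
  rw [gamma, hh, zero_add, AddMonoidAlgebra.coeff_single, Finsupp.single_eq_same]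

theorem br_vol_vol : B.br W hW (dens 1 1) (dens 1 1) = dens 2 (B.theta hW) := by
  obtain ⟨h, hh⟩ := (B.isBracket W hW).weight 1 1 1 1
  rw [theta, hh, one_add_one_eq_two, AddMonoidAlgebra.coeff_single, Finsupp.single_eq_same]

theorem coord_parity (a : Idx n m) : (dens 0 (coord n m W a)).HasParity (par a) :=
  .dens (coord_mem_parity a) 0

theorem S_parity (a b : Idx n m) : B.S hW a b ∈ parity n m W (par a + par b + 1) :=
  br_parity (coord_parity a) (coord_parity b) 0

theorem gamma_parity (a : Idx n m) : B.gamma hW a ∈ parity n m W (par a + 1) := by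
  have := br_parity (B := B) (hW := hW) (coord_parity a) (one_parity 1) 1
  rwa [add_zero] at this

theorem theta_parity : B.theta hW ∈ parity n m W 1 :=
  br_parity (B := B) (hW := hW) (one_parity 1) (one_parity 1) 2

theorem S_symm (a b : Idx n m) : B.S hW a b = sgn (par a * par b) • B.S hW b a := by
  rw [S, br_symm (coord_parity a) (coord_parity b)]
  rfl

theorem Gam_parity {f : SF n m W} (hf : f ∈ parity n m W p) :
    B.Gam hW f ∈ parity n m W (p + 1) := by
  refine sum_mem fun b _ => ?_
  have := mul_mem_parity (B.gamma_parity hW b) (pd_mem_parity b hf)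
  rwa [show par b + 1 + (par b + p) = p + 1 + (par b + par b) by ring,
    CharTwo.add_self_eq_zero, add_zero] at this

theorem br_coord_dens_zero (a : Idx n m) (f : SF n m W) :
    B.br W hW (dens 0 (coord n m W a)) (dens 0 f) = dens 0 (B.ham hW a f) := by
  rw [br_dens_zero (coord_parity a), ham, Dens.dens_sum]
  refine Finset.sum_congr rfl fun b _ => ?_
  rw [br_coord_coord, Dens.dens_mul, add_zero]

theorem br_vol_dens_zero (f : SF n m W) :
    B.br W hW (dens 1 1) (dens 0 f) = dens 1 (B.Gam hW f) := by
  rw [br_dens_zero (one_parity 1), Gam, Dens.dens_sum]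
  refine Finset.sum_congr rfl fun b _ => ?_
  rw [br_symm (one_parity 1) (coord_parity b), zero_mul, sgn_zero, one_smul, br_coord_vol,
    Dens.dens_mul, add_zero]

theorem br_coord_dens (a : Idx n m) {f : SF n m W} (hf : f ∈ parity n m W p) (w : ℝ) :
    B.br W hW (dens 0 (coord n m W a)) (dens w f) =
      dens w (B.ham hW a f + (sgn ((par a + 1) * p) * w) • (f * B.gamma hW a)) := by
  rw [Dens.dens_eq_mul w f, br_mul (coord_parity a) (.dens hf 0), br_coord_dens_zero, br_pow,
    br_coord_vol, mul_smul_comm, Dens.dens_mul, Dens.dens_mul, Dens.dens_mul, smul_smul,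
    Dens.dens_add, Dens.dens_smul]
  simp

theorem br_vol_dens {f : SF n m W} (hf : f ∈ parity n m W p) (w : ℝ) :
    B.br W hW (dens 1 1) (dens w f) =
      dens (w + 1) (B.Gam hW f + (sgn p * w) • (f * B.theta hW)) := by
  rw [Dens.dens_eq_mul w f, br_mul (one_parity 1) (.dens hf 0), br_vol_dens_zero, br_pow,
    br_vol_vol, mul_smul_comm, Dens.dens_mul, Dens.dens_mul, Dens.dens_mul, smul_smul,
    Dens.dens_add, Dens.dens_smul, show 0 + (w - 1 + 2) = w + 1 by ring, add_comm 1 w]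
  simp

end BracketOn

/-! ### The Jacobi identity on generators, and its simplification by a potential of `γ`. -/

namespace BracketOn
variable {D : Opens (E n)} (B : BracketOn n m D) (hW : W ≤ D)

/-- The Jacobi identity for `xᵃ, xᵇ, xᶜ`. -/
def J0 (a b c : Idx n m) : SF n m W :=
  sgn ((par b + 1) * par c) • B.ham hW c (B.S hW a b) +
    sgn ((par a + 1) * par b) • B.ham hW b (B.S hW c a) +
    sgn ((par c + 1) * par a) • B.ham hW a (B.S hW b c)

/-- The Jacobi identity for `xᵃ, xᵇ, Dx`. -/
def J1 (a b : Idx n m) : SF n m W :=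
  B.Gam hW (B.S hW a b) + sgn ((par a + 1) * par b) • B.ham hW b (B.gamma hW a) +
    sgn (par a) • B.ham hW a (B.gamma hW b)

/-- The Jacobi identity for `xᵃ, Dx, Dx`. -/
def J2 (a : Idx n m) : SF n m W :=
  (2 : ℝ) • B.Gam hW (B.gamma hW a) + sgn (par a) • B.ham hW a (B.theta hW)

theorem dens_zero_br_coord {p : ZMod 2} {f : SF n m W} (hf : f ∈ parity n m W p) (a : Idx n m) :
    B.br W hW (dens 0 f) (dens 0 (coord n m W a)) = dens 0 (sgn (p * par a) • B.ham hW a f) := by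
  rw [br_symm (.dens hf 0) (coord_parity a), br_coord_dens_zero, Dens.dens_smul]

theorem br_even_comm {p : ZMod 2} {ψ χ : Dens n m W} (hψ : ψ.HasParity p) (hχ : χ.HasParity 0) :
    B.br W hW ψ χ = B.br W hW χ ψ := by
  simpa using br_symm (B := B) (hW := hW) hψ hχ

theorem mul_self_of_odd {f : SF n m W} (hf : f ∈ parity n m W 1) : f * f = 0 := by
  have h := supercomm hf hf
  rw [mul_one, sgn_one, neg_one_smul, eq_neg_iff_add_eq_zero, ← two_smul ℝ] at h
  simpa using h

theorem jac_coord (a b c : Idx n m) : B.jac hW (dens 0 (coord n m W a)) (dens 0 (coord n m W b))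
    (dens 0 (coord n m W c)) (par a) (par b) (par c) = dens 0 (B.J0 hW a b c) := by
  rw [jac, br_coord_coord, br_coord_coord, br_coord_coord, dens_zero_br_coord _ _ (S_parity _ _ _ _),
    dens_zero_br_coord _ _ (S_parity _ _ _ _), dens_zero_br_coord _ _ (S_parity _ _ _ _), J0]
  simp only [Dens.dens_add, Dens.dens_smul, smul_smul]
  rcases zmod2_cases (par a) with h | h <;> rcases zmod2_cases (par b) with h' | h' <;>
    rcases zmod2_cases (par c) with h'' | h'' <;> simp [h, h', h'']

theorem dens_one_br_coord {p : ZMod 2} {f : SF n m W} (hf : f ∈ parity n m W p) (w : ℝ)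
    (a : Idx n m) :
    B.br W hW (dens w f) (dens 0 (coord n m W a)) = dens w (sgn (p * par a) •
      (B.ham hW a f + (sgn ((par a + 1) * p) * w) • (f * B.gamma hW a))) := by
  rw [br_symm (.dens hf w) (coord_parity a), br_coord_dens _ _ _ hf, ← Dens.dens_smul]

/-- The two terms containing the product of `γᵃ` and `γᵇ` cancel by supercommutativity. -/
theorem jac_coord_coord_vol (a b : Idx n m) : B.jac hW (dens 0 (coord n m W a))
    (dens 0 (coord n m W b)) (dens 1 1) (par a) (par b) 0 = dens 1 (B.J1 hW a b) := by
  rw [jac, br_coord_coord, br_even_comm _ _ (.dens (S_parity _ _ _ _) 0) (one_parity 1),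
    br_vol_dens_zero, ← br_even_comm _ _ (coord_parity a) (one_parity 1), br_coord_vol,
    br_coord_vol, dens_one_br_coord _ _ (gamma_parity _ _ _),
    dens_one_br_coord _ _ (gamma_parity _ _ _), J1,
    supercomm (gamma_parity B hW b) (gamma_parity B hW a)]
  simp only [Dens.dens_add, Dens.dens_smul, smul_smul, smul_add]
  rcases zmod2_cases (par a) with h | h <;> rcases zmod2_cases (par b) with h' | h' <;>
    simp [h, h'] <;> abel

/-- Two of the three terms coincide, whence the factor 2 in `J2`; the products of `γᵃ` with `θ`
cancel. -/
theorem jac_coord_vol_vol (a : Idx n m) : B.jac hW (dens 0 (coord n m W a))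
    (dens 1 1) (dens 1 1) (par a) 0 0 = dens 2 (B.J2 hW a) := by
  rw [jac, ← br_even_comm _ _ (coord_parity a) (one_parity 1), br_coord_vol, br_vol_vol,
    br_even_comm _ _ (.dens (gamma_parity _ _ _) 1) (one_parity 1),
    br_vol_dens _ _ (gamma_parity _ _ _), dens_one_br_coord _ _ (theta_parity _ _), J2,
    supercomm (theta_parity B hW) (gamma_parity B hW a), one_add_one_eq_two]
  simp only [Dens.dens_add, Dens.dens_smul, smul_smul, smul_add, two_smul]
  rcases zmod2_cases (par a) with h | h <;> simp [h, two_smul] <;> abel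

theorem jac_vol (h : B.Gam hW (B.theta hW) = 0) :
    B.jac hW (dens 1 1) (dens 1 1) (dens 1 1) 0 0 0 = 0 := by
  rw [jac, br_vol_vol, br_even_comm _ _ (.dens (theta_parity _ _) 2) (one_parity 1),
    br_vol_dens _ _ (theta_parity _ _), h, mul_self_of_odd (theta_parity B hW)]
  simp

/-- The Jacobi identity in coordinates. -/
theorem jac_eq_zero (h0 : ∀ a b c, B.J0 hW a b c = 0) (h1 : ∀ a b, B.J1 hW a b = 0)
    (h2 : ∀ a, B.J2 hW a = 0) (h3 : B.Gam hW (B.theta hW) = 0) {ψ χ φ : Dens n m W}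
    {p q r : ZMod 2} (hψ : ψ.HasParity p) (hχ : χ.HasParity q) (hφ : φ.HasParity r) :
    B.jac hW ψ χ φ p q r = 0 := by
  have k1 : ∀ a b, B.jac hW (dens 0 (coord n m W a)) (dens 0 (coord n m W b)) (dens 1 1)
      (par a) (par b) 0 = 0 := fun a b => by rw [jac_coord_coord_vol, h1, Dens.dens_zero]
  have k2 : ∀ a, B.jac hW (dens 0 (coord n m W a)) (dens 1 1) (dens 1 1) (par a) 0 0 = 0 :=
    fun a => by rw [jac_coord_vol_vol, h2, Dens.dens_zero]
  refine jac_eq_zero_of_gen (fun a b c => ?_) hψ hχ hφ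
  rcases a with _ | a <;> rcases b with _ | b <;> rcases c with _ | c <;>
    simp only [gen, genPar]
  · exact jac_vol B hW h3
  · rw [← jac_cycle, k2]
  · rw [← jac_cycle, ← jac_cycle, k2]
  · rw [← jac_cycle, ← jac_cycle, k1]
  · exact k2 a
  · rw [← jac_cycle, k1]
  · exact k1 a b
  · rw [jac_coord, h0, Dens.dens_zero]

theorem ham_neg (a : Idx n m) (f : SF n m W) : B.ham hW a (-f) = -B.ham hW a f := by
  simp only [ham, map_neg, mul_neg, Finset.sum_neg_distrib]

theorem ham_add (a : Idx n m) (f g : SF n m W) :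
    B.ham hW a (f + g) = B.ham hW a f + B.ham hW a g := by
  simp only [ham, map_add, mul_add, Finset.sum_add_distrib]

theorem Gam_neg (f : SF n m W) : B.Gam hW (-f) = -B.Gam hW f := by
  simp only [Gam, map_neg, mul_neg, Finset.sum_neg_distrib]

variable {B hW} {A : SF n m W}

/-- Both sides are determined by the coordinates, and `{A; xᵃ} = {xᵃ; A} = -γᵃ`. Equivalently, the
volume form `e^A Dx` has zero bracket with functions. Hence Jacobi identities with `A` inserted can
replace those with `Dx`. -/
theorem br_potential (hA : A ∈ parity n m W 0) (hgam : ∀ a, B.gamma hW a = -B.ham hW a A)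
    (f : SF n m W) :
    B.br W hW (dens 0 A) (dens 0 f) = dens 0 (-B.Gam hW f) := by
  rw [br_dens_zero (.dens hA 0), Gam, ← Finset.sum_neg_distrib, Dens.dens_sum]
  refine Finset.sum_congr rfl fun b _ => ?_
  rw [dens_zero_br_coord _ _ hA, zero_mul, sgn_zero, one_smul, Dens.dens_mul, hgam, add_zero,
    neg_mul, neg_neg]

/-- This is, up to sign, the Jacobi identity of the functions `xᵃ, xᵇ, A`. -/
theorem J1_eq_zero (hA : A ∈ parity n m W 0) (hgam : ∀ a, B.gamma hW a = -B.ham hW a A)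
    (h0 : ∀ a b c, B.J0 hW a b c = 0) (a b : Idx n m) : B.J1 hW a b = 0 := by
  have hj := jac_eq_zero_of_coord (B := B) (hW := hW) (fun a b c => by
    rw [jac_coord, h0, Dens.dens_zero]) (coord_mem_parity a) (coord_mem_parity b) hA
  rw [jac, br_coord_coord, br_even_comm _ _ (.dens (S_parity _ _ _ _) 0) (.dens hA 0),
    br_potential hA hgam, ← br_even_comm _ _ (coord_parity a) (.dens hA 0), br_coord_dens_zero,
    br_coord_dens_zero, ← neg_eq_iff_eq_neg.2 (hgam a), ← neg_eq_iff_eq_neg.2 (hgam b),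
    dens_zero_br_coord _ _ (neg_mem (gamma_parity _ _ _)),
    dens_zero_br_coord _ _ (neg_mem (gamma_parity _ _ _))] at hj
  simp only [← Dens.dens_smul, ← Dens.dens_add, smul_smul, ham_neg] at hj
  have hj' := Dens.dens_injective 0 (hj.trans (Dens.dens_zero 0).symm)
  rw [J1, ← neg_eq_zero, ← hj']
  rcases zmod2_cases (par a) with h | h <;> rcases zmod2_cases (par b) with h' | h' <;>
    simp [h, h'] <;> abel

/-- The Jacobi identity of `xᵃ, A, A` expresses `2 Γ(γᵃ)` through `{xᵃ; Γ(A)}`. -/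
theorem J2_eq (hA : A ∈ parity n m W 0) (hgam : ∀ a, B.gamma hW a = -B.ham hW a A)
    (h0 : ∀ a b c, B.J0 hW a b c = 0) (a : Idx n m) :
    B.J2 hW a = sgn (par a) • B.ham hW a (B.theta hW + B.Gam hW A) := by
  have hj := jac_eq_zero_of_coord (B := B) (hW := hW) (fun a b c => by
    rw [jac_coord, h0, Dens.dens_zero]) (coord_mem_parity a) hA hA
  rw [jac, br_potential hA hgam A, ← br_even_comm _ _ (coord_parity a) (.dens hA 0),
    br_coord_dens_zero, ← neg_eq_iff_eq_neg.2 (hgam a),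
    br_even_comm _ _ (.dens (neg_mem (gamma_parity _ _ _)) 0) (.dens hA 0),
    br_potential hA hgam, dens_zero_br_coord _ _ (neg_mem (Gam_parity _ _ hA))] at hj
  simp only [← Dens.dens_smul, ← Dens.dens_add, smul_smul, ham_neg, Gam_neg] at hj
  have hj' := Dens.dens_injective 0 (hj.trans (Dens.dens_zero 0).symm)
  rw [J2, ham_add, ← sub_eq_zero, ← hj']
  rcases zmod2_cases (par a) with h | h <;> simp [h, two_smul] <;> abel

/-- The three terms of the Jacobi identity of `A, A, A` are equal, and 3 is invertible. -/
theorem Gam_Gam_potential (hA : A ∈ parity n m W 0) (hgam : ∀ a, B.gamma hW a = -B.ham hW a A)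
    (h0 : ∀ a b c, B.J0 hW a b c = 0) : B.Gam hW (B.Gam hW A) = 0 := by
  have hj := jac_eq_zero_of_coord (B := B) (hW := hW) (fun a b c => by
    rw [jac_coord, h0, Dens.dens_zero]) hA hA hA
  rw [jac, br_potential hA hgam A,
    br_even_comm _ _ (.dens (neg_mem (Gam_parity _ _ hA)) 0) (.dens hA 0),
    br_potential hA hgam, Gam_neg, neg_neg] at hj
  simp only [← Dens.dens_add, mul_zero, sgn_zero, one_smul] at hj
  have hj' := Dens.dens_injective 0 (hj.trans (Dens.dens_zero 0).symm)
  have h3 : (3 : ℝ) • B.Gam hW (B.Gam hW A) = 0 := by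
    rw [← hj', show (3 : ℝ) = 1 + 1 + 1 by norm_num, add_smul, add_smul, one_smul]
  simpa using h3

/-- The Jacobi identity, when `γ` has a potential. -/
theorem jac_eq_zero_of_potential (hA : A ∈ parity n m W 0)
    (hgam : ∀ a, B.gamma hW a = -B.ham hW a A) (h0 : ∀ a b c, B.J0 hW a b c = 0)
    (hth : B.theta hW = -B.Gam hW A) {ψ χ φ : Dens n m W} {p q r : ZMod 2}
    (hψ : ψ.HasParity p) (hχ : χ.HasParity q) (hφ : φ.HasParity r) :
    B.jac hW ψ χ φ p q r = 0 := by
  refine jac_eq_zero B hW h0 (J1_eq_zero hA hgam h0) (fun a => ?_) ?_ hψ hχ hφ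
  · rw [J2_eq hA hgam h0, hth, neg_add_cancel]
    simp [ham]
  · rw [hth, Gam_neg, Gam_Gam_potential hA hgam h0, neg_zero]

end BracketOn

/-! ### The super Poincaré lemma for 1-forms -/

namespace SF

/-- The substitution of odd variables by linear combinations of odd variables. -/
def mapOdd (L : (Fin m → ℝ) →ₗ[ℝ] (Fin m → ℝ)) : SF n m W →ₐ[ℝ] SF n m W :=
  (SF.equiv n m W).symm.toAlgHom.comp
    ((Algebra.TensorProduct.map (AlgHom.id ℝ (Smooth W)) (ExteriorAlgebra.map L)).comp
      (SF.equiv n m W).toAlgHom)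

theorem mapOdd_tmul (L : (Fin m → ℝ) →ₗ[ℝ] (Fin m → ℝ)) (f : Smooth W) (η : Gr m) :
    mapOdd L (tmul f η) = tmul f (ExteriorAlgebra.map L η) := rfl

theorem mapOdd_comp (L L' : (Fin m → ℝ) →ₗ[ℝ] (Fin m → ℝ)) (f : SF n m W) :
    mapOdd (L ∘ₗ L') f = mapOdd L (mapOdd L' f) := by
  induction f using SF.induction_on with
  | add f g hf hg => simp only [map_add, hf, hg]
  | tmul f η =>
    rw [mapOdd_tmul, mapOdd_tmul, mapOdd_tmul, ← ExteriorAlgebra.map_comp_map]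
    rfl

theorem mapOdd_id (f : SF n m W) : mapOdd LinearMap.id f = f := by
  induction f using SF.induction_on with
  | add f g hf hg => simp only [map_add, hf, hg]
  | tmul f η => rw [mapOdd_tmul, ExteriorAlgebra.map_id]; rfl

theorem mapOdd_zero (f : SF n m W) : mapOdd 0 f = tmul (body f) 1 := by
  induction f using SF.induction_on with
  | add f g hf hg => simp only [map_add, hf, hg, add_tmul]
  | tmul f η =>
    have : ExteriorAlgebra.map (0 : (Fin m → ℝ) →ₗ[ℝ] (Fin m → ℝ)) =
        (Algebra.ofId ℝ (Gr m)).comp ExteriorAlgebra.algebraMapInv := by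
      ext v
      simp [ExteriorAlgebra.algebraMapInv]
    rw [mapOdd_tmul, this, body_tmul, smul_tmul, ← tmul_smul]
    congr 1
    exact Algebra.algebraMap_eq_smul_one (R := ℝ) (A := Gr m) _

/-- The projection killing the basis vector `k`. -/
def killOne (k : Fin m) : (Fin m → ℝ) →ₗ[ℝ] (Fin m → ℝ) :=
  LinearMap.id - (LinearMap.proj k).smulRight (Pi.single k 1)

/-- An element is affine in each `ξᵏ`, so setting `ξᵏ = 0` subtracts `ξᵏ ∂ₖ`. In particular an
element with `∂ₖ = 0` is unchanged. -/
theorem map_killOne (k : Fin m) (η : Gr m) : ExteriorAlgebra.map (killOne k) η =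
    η - ExteriorAlgebra.ι ℝ (Pi.single k 1) * CliffordAlgebra.contractLeft
      (Q := (0 : QuadraticForm ℝ (Fin m → ℝ))) (LinearMap.proj k) η := by
  induction η using CliffordAlgebra.left_induction with
  | algebraMap r => simp
  | add x y hx hy => rw [map_add, hx, hy, map_add, mul_add]; abel
  | ι_mul x v hx =>
    have hv : ExteriorAlgebra.map (killOne k) (CliffordAlgebra.ι 0 v) =
        CliffordAlgebra.ι 0 v - v k • ExteriorAlgebra.ι ℝ (Pi.single k (1 : ℝ)) := by
      refine (ExteriorAlgebra.map_apply_ι _ _).trans ?_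
      simp [killOne]
    have hsq : ExteriorAlgebra.ι ℝ (Pi.single k 1 : Fin m → ℝ) *
        ExteriorAlgebra.ι ℝ (Pi.single k 1 : Fin m → ℝ) = 0 :=
      ExteriorAlgebra.ι_sq_zero _
    have hsw : ExteriorAlgebra.ι ℝ (Pi.single k 1 : Fin m → ℝ) * CliffordAlgebra.ι 0 v =
        -(CliffordAlgebra.ι 0 v * ExteriorAlgebra.ι ℝ (Pi.single k 1 : Fin m → ℝ)) :=
      eq_neg_of_add_eq_zero_left (ExteriorAlgebra.ι_add_mul_swap _ _)
    rw [map_mul, hx, hv, CliffordAlgebra.contractLeft_ι_mul, LinearMap.proj_apply, sub_mul, mul_sub,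
      mul_sub, mul_sub, smul_mul_assoc, smul_mul_assoc, ← mul_assoc _ _ (CliffordAlgebra.contractLeft _ _),
      ← mul_assoc _ _ (CliffordAlgebra.contractLeft _ _),
      ← mul_assoc _ _ (CliffordAlgebra.contractLeft _ _), hsq, hsw, mul_smul_comm]
    simp only [zero_mul, smul_zero, neg_mul]
    abel

theorem mapOdd_killOne (k : Fin m) (f : SF n m W) :
    mapOdd (killOne k) f = f - coord n m W (Sum.inr k) * pd (Sum.inr k) f := by
  induction f using SF.induction_on with
  | add f g hf hg => simp only [map_add, hf, hg, mul_add]; abel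
  | tmul f η =>
    rw [mapOdd_tmul, map_killOne, pd_inr_tmul, coord, Sum.elim_inr, tmul_mul_tmul, one_mul]
    exact TensorProduct.tmul_sub _ _ _

/-- The projection killing the basis vectors in `s`. -/
def kill (s : Finset (Fin m)) : (Fin m → ℝ) →ₗ[ℝ] (Fin m → ℝ) :=
  LinearMap.pi fun i => if i ∈ s then 0 else LinearMap.proj i

/-- A function that does not depend on the odd coordinates is a function of the even ones. -/
theorem eq_tmul_body {f : SF n m W} (hf : ∀ k, pd (Sum.inr k) f = 0) : f = tmul (body f) 1 := by
  have key : ∀ s : Finset (Fin m), mapOdd (kill s) f = f := by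
    intro s
    induction s using Finset.induction_on with
    | empty =>
      have : kill (∅ : Finset (Fin m)) = LinearMap.id := by ext i j; simp [kill]
      rw [this, mapOdd_id]
    | insert k s hk ih =>
      have : kill (insert k s) = killOne k ∘ₗ kill s := by
        ext i j
        by_cases hj : j = k
        · subst hj
          simp [kill, killOne, hk]
        · simp [kill, killOne, hj]
      rw [this, mapOdd_comp, ih, mapOdd_killOne, hf, mul_zero, sub_zero]
  have h := key Finset.univ
  rw [show kill (Finset.univ : Finset (Fin m)) = 0 by ext i j; simp [kill], mapOdd_zero] at h
  exact h.symm

theorem body_injective_tmul {f g : Smooth W} (h : (tmul f 1 : SF n m W) = tmul g 1) : f = g := by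
  have := congrArg body h
  simpa only [body_tmul, map_one, one_smul] using this

/-- Odd variables are integrated one by one without integrals: with `hₖ = gₖ - ∂ₖA`, the correction
is `A + ξᵏhₖ`. Closedness gives `∂ₗhₖ = -∂ₖhₗ`. Hence `∂ₖhₖ = 0`, so the new equation holds, and
`∂ₗhₖ = 0` for `l` already treated, so the old ones persist. -/
theorem exists_odd_primitive (g : Idx n m → SF n m W) (hp : ∀ a, g a ∈ parity n m W (par a))
    (hg : ∀ a b, pd a (g b) = sgn (par a * par b) • pd b (g a)) (s : Finset (Fin m)) :
    ∃ A ∈ parity n m W 0, ∀ k ∈ s, pd (Sum.inr k) A = g (Sum.inr k) := by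
  induction s using Finset.induction_on with
  | empty => exact ⟨0, zero_mem _, by simp⟩
  | insert k s hk ih =>
    obtain ⟨A, hA, hAs⟩ := ih
    have hodd : ∀ k, g (Sum.inr k) - pd (Sum.inr k) A ∈ parity n m W 1 := fun k => by
      have h : pd (Sum.inr k) A ∈ parity n m W (1 + 0) := pd_mem_parity (Sum.inr k) hA
      have h' : g (Sum.inr k) ∈ parity n m W 1 := hp (Sum.inr k)
      rw [add_zero] at h
      exact sub_mem h' h
    have hcl : ∀ l k : Fin m, pd (Sum.inr l) (g (Sum.inr k) - pd (Sum.inr k) A) =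
        -pd (Sum.inr k) (g (Sum.inr l) - pd (Sum.inr l) A) := fun l k => by
      rw [map_sub, map_sub, hg, pd_comm]
      simp [par]
      abel
    have hd : ∀ l, pd (Sum.inr l) (coord n m W (Sum.inr k) *
        (g (Sum.inr k) - pd (Sum.inr k) A)) =
        (if l = k then 1 else 0) * (g (Sum.inr k) - pd (Sum.inr k) A) -
        coord n m W (Sum.inr k) * pd (Sum.inr l) (g (Sum.inr k) - pd (Sum.inr k) A) := fun l => by
      rw [pd_mul (coord_mem_parity _), pd_coord]
      simp [par, sub_eq_add_neg]
    have hx : coord n m W (Sum.inr k) ∈ parity n m W 1 := coord_mem_parity (Sum.inr k)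
    have hm := mul_mem_parity hx (hodd k)
    rw [zmod2_one_add_one] at hm
    refine ⟨A + coord n m W (Sum.inr k) * (g (Sum.inr k) - pd (Sum.inr k) A),
      add_mem hA hm, fun l hl => ?_⟩
    rw [map_add, hd]
    by_cases hlk : l = k
    · subst hlk
      have h0 : pd (Sum.inr l) (g (Sum.inr l) - pd (Sum.inr l) A) = 0 := by
        have h := hcl l l
        rw [eq_neg_iff_add_eq_zero, ← two_smul ℝ] at h
        simpa using h
      rw [h0]
      simp
    · have hls : l ∈ s := (Finset.mem_insert.1 hl).resolve_left hlk
      rw [hcl, hAs l hls]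
      simp [hlk]

/-- The Poincaré lemma for closed 1-forms on a superdomain. -/
theorem exists_primitive (hW : Convex ℝ (W : Set (E n))) (g : Idx n m → SF n m W)
    (hp : ∀ a, g a ∈ parity n m W (par a))
    (hg : ∀ a b, pd a (g b) = sgn (par a * par b) • pd b (g a)) :
    ∃ A ∈ parity n m W 0, ∀ a, pd a A = g a := by
  obtain ⟨A, hA, hAs⟩ := exists_odd_primitive g hp hg Finset.univ
  -- After subtracting `dA` the form has no odd components. Closedness then makes its even
  -- components independent of the odd coordinates, leaving an ordinary closed 1-form on a convex
  -- set.
  have hk : ∀ (i : Fin n), g (Sum.inl i) - pd (Sum.inl i) A =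
      tmul (body (g (Sum.inl i) - pd (Sum.inl i) A)) 1 := fun i => eq_tmul_body fun k => by
    rw [map_sub, hg, pd_comm, hAs k (Finset.mem_univ k), sub_self]
  obtain ⟨b, hb⟩ := Smooth.exists_pderiv_eq hW
    (fun i => body (g (Sum.inl i) - pd (Sum.inl i) A)) fun i j => by
      refine body_injective_tmul (m := m) ?_
      rw [← pd_inl_tmul, ← pd_inl_tmul, ← hk, ← hk, map_sub, map_sub, hg, pd_comm]
      simp [par]
  refine ⟨A + tmul b 1, add_mem hA (tmul_mem_parity b (CliffordAlgebra.one_le_evenOdd_zero _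
    (Submodule.one_le.1 le_rfl))), fun a => ?_⟩
  rcases a with i | k
  · rw [map_add, pd_inl_tmul, hb, ← hk]
    abel
  · rw [map_add, pd_inr_tmul, CliffordAlgebra.contractLeft_one, tmul_zero, add_zero,
      hAs k (Finset.mem_univ k)]

/-- An odd function with vanishing derivatives is zero. -/
theorem eq_zero_of_pd_eq_zero {f : SF n m W} (hf : f ∈ parity n m W 1) (h : ∀ a, pd a f = 0) :
    f = 0 := by
  -- Without dependence on the odd coordinates `f` is fixed by the grading involution, which also
  -- negates it.
  have h1 := eps_of_mem_parity hf
  rw [eq_tmul_body (f := f) fun k => h _, eps_tmul, map_one, sgn_one, neg_one_smul,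
    eq_neg_iff_add_eq_zero, ← two_smul ℝ] at h1
  rw [eq_tmul_body (f := f) fun k => h _]
  simpa using h1

end SF

/-- The coefficients of `dω`. -/
def dform (om : Idx n m → Idx n m → SF n m W) (a b c : Idx n m) : SF n m W :=
  sgn (par c * (par a + par b)) • pd c (om b a)
    + sgn ((par c + 1) * (par a + par b)) • sgn (par a * (par b + par c)) • pd a (om c b)
    + sgn ((par b + 1) * (par c + par a)) • sgn (par b * (par c + par a)) • pd b (om a c)

theorem sum_cycle {ι M : Type*} [Fintype ι] [AddCommMonoid M] (F : ι → ι → ι → M) :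
    ∑ x, ∑ y, ∑ z, F x y z = ∑ y, ∑ z, ∑ x, F x y z := by
  rw [Finset.sum_comm]
  exact Finset.sum_congr rfl fun y _ => Finset.sum_comm

/-! ### The inverse matrix `ω`, and `J0` as the exterior derivative of `ω`. -/

namespace BracketOn
variable {D : Opens (E n)} {B : BracketOn n m D} {hW : W ≤ D} {om : Idx n m → Idx n m → SF n m W}

/-- `om` is the inverse matrix of `S`. -/
structure IsInv (B : BracketOn n m D) (hW : W ≤ D) (om : Idx n m → Idx n m → SF n m W) :
    Prop where
  S_mul : ∀ a c, ∑ b, B.S hW a b * om b c = if a = c then 1 else 0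
  mul_S : ∀ a c, ∑ b, om a b * B.S hW b c = if a = c then 1 else 0

namespace IsInv

theorem eq_of_S_mul (h : IsInv B hW om) (c : Idx n m) {Y Z : Idx n m → SF n m W}
    (hY : ∀ a, ∑ b, B.S hW a b * Y b = Z a) : Y c = ∑ a, om c a * Z a := by
  simp only [← hY, Finset.mul_sum, ← mul_assoc]
  rw [Finset.sum_comm]
  simp only [← Finset.sum_mul, h.mul_S, ite_mul, one_mul, zero_mul]
  simp

theorem eq_zero_of_S_mul (h : IsInv B hW om) {Y : Idx n m → SF n m W}
    (hY : ∀ a, ∑ b, B.S hW a b * Y b = 0) (c : Idx n m) : Y c = 0 := by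
  rw [h.eq_of_S_mul c (Z := fun _ => 0) hY]
  simp

theorem eq_zero_of_ham (h : IsInv B hW om) {f : SF n m W} (hf : ∀ a, B.ham hW a f = 0)
    (b : Idx n m) : pd b f = 0 :=
  h.eq_zero_of_S_mul (Y := fun b => pd b f) hf b

theorem unique_right (h : IsInv B hW om) {om' : Idx n m → Idx n m → SF n m W}
    (h' : ∀ a c, ∑ b, B.S hW a b * om' b c = if a = c then 1 else 0) (a c : Idx n m) :
    om' a c = om a c := by
  rw [h.eq_of_S_mul a (Y := fun b => om' b c) (fun a => h' a c)]
  simp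

theorem unique_left (h : IsInv B hW om) {om' : Idx n m → Idx n m → SF n m W}
    (h' : ∀ a c, ∑ b, om' a b * B.S hW b c = if a = c then 1 else 0) (a c : Idx n m) :
    om' a c = om a c := by
  have : om' a c = ∑ e, ∑ b, om' a b * (B.S hW b e * om e c) := by
    rw [Finset.sum_comm]
    simp only [← Finset.mul_sum, h.S_mul]
    simp
  rw [this]
  simp only [← mul_assoc, ← Finset.sum_mul, h']
  simp

/-- Applying the grading involution to `Sω = 1`, with suitable signs, gives another right inverse of
`S`; uniqueness of inverses is the homogeneity of `ω`. -/
theorem om_parity (h : IsInv B hW om) (a b : Idx n m) :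
    om a b ∈ parity n m W (par a + par b + 1) := by
  have key := h.unique_right (om' := fun a b => sgn (par a + par b + 1) • SF.eps (om a b))
    (fun a c => by
      have : ∀ b, B.S hW a b * (sgn (par b + par c + 1) • SF.eps (om b c)) =
          sgn (par a + par c) • SF.eps (B.S hW a b * om b c) := fun b => by
        have hs : ∀ a b c : ZMod 2, b + c + 1 = a + c + (a + b + 1) := by decide
        rw [map_mul, eps_of_mem_parity (S_parity B hW a b), mul_smul_comm, smul_mul_assoc, smul_smul,
          ← sgn_add, ← hs]
      simp only [this, ← Finset.smul_sum, ← map_sum, h.S_mul]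
      split_ifs with hac
      · rw [hac, CharTwo.add_self_eq_zero]
        simp
      · simp) a b
  rw [mem_parity_iff]
  nth_rw 2 [← key]
  rw [smul_smul, sgn_mul_self, one_smul]

/-- The signed transpose of `ω` is a left inverse of `S`, by the symmetry of `S` and
supercommutativity, so it equals `ω`. -/
theorem om_symm (h : IsInv B hW om) (a b : Idx n m) :
    om a b = sgn ((par a + 1) * (par b + 1)) • om b a := by
  refine (h.unique_left (om' := fun a b => sgn ((par a + 1) * (par b + 1)) • om b a)
    (fun c a => ?_) a b).symm
  have hs : ∀ a b c : ZMod 2, (c + 1) * (b + 1) + a * b + (b + c + 1) * (a + b + 1) =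
      (c + 1) * a := by decide
  have : ∀ b, sgn ((par c + 1) * (par b + 1)) • om b c * B.S hW b a =
      sgn ((par c + 1) * par a) • (B.S hW a b * om b c) := fun b => by
    rw [smul_mul_assoc, S_symm, mul_smul_comm, supercomm (h.om_parity b c) (S_parity B hW a b),
      smul_smul, smul_smul, ← sgn_add, ← sgn_add, ← hs (par a) (par b) (par c),
      mul_comm (par b) (par a)]
  simp only [this, ← Finset.smul_sum, h.S_mul]
  by_cases hac : a = c
  · subst hac
    have h0 : ∀ a : ZMod 2, (a + 1) * a = 0 := by decide
    rw [h0]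
    simp
  · simp [hac, Ne.symm hac]

/-- Differentiate `Sω = 1` and multiply by `S` on the right. -/
theorem pd_S (h : IsInv B hW om) (d a b : Idx n m) : pd d (B.S hW a b) =
    -∑ f, ∑ e, sgn (par d * (par a + par f + 1)) •
      (B.S hW a f * pd d (om f e) * B.S hW e b) := by
  have h0 : ∀ c, ∑ f, pd d (B.S hW a f) * om f c =
      -∑ f, sgn (par d * (par a + par f + 1)) • (B.S hW a f * pd d (om f c)) := fun c => by
    have := congrArg (pd d) (h.S_mul a c)
    rw [apply_ite (pd d), pd_one, map_zero, ite_self, map_sum] at this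
    simp only [pd_mul (S_parity B hW a _), Finset.sum_add_distrib] at this
    exact eq_neg_of_add_eq_zero_left this
  have h1 : pd d (B.S hW a b) = ∑ e, (∑ f, pd d (B.S hW a f) * om f e) * B.S hW e b := by
    simp only [Finset.sum_mul, mul_assoc]
    rw [Finset.sum_comm]
    simp only [← Finset.mul_sum, h.mul_S]
    simp
  rw [h1]
  simp only [h0, neg_mul, Finset.sum_neg_distrib, Finset.sum_mul, smul_mul_assoc]
  rw [Finset.sum_comm]

/-- The exponent of the sign in `ham_S`. -/
def hamExp (a b c f e d : ZMod 2) : ZMod 2 :=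
  (b + 1) * c + d * (a + f + 1) + e * b + (d + (f + e + 1)) * (b + e + 1)
    + (c + d + 1) * (a + f + 1 + (b + e + 1))

/-- The factors are moved into one fixed order, with `hamExp` collecting the signs, so that the
three cyclic terms of `J0` become comparable. -/
theorem ham_S (h : IsInv B hW om) (a b c : Idx n m) :
    sgn ((par b + 1) * par c) • B.ham hW c (B.S hW a b) =
      -∑ f, ∑ e, ∑ d, sgn (hamExp (par a) (par b) (par c) (par f) (par e) (par d)) •
        (B.S hW a f * B.S hW b e * B.S hW c d * pd d (om f e)) := by
  rw [ham]
  simp only [h.pd_S, mul_neg, Finset.sum_neg_distrib, smul_neg, Finset.mul_sum, Finset.smul_sum]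
  rw [sum_cycle, neg_inj]
  refine Finset.sum_congr rfl fun f _ => Finset.sum_congr rfl fun e _ =>
    Finset.sum_congr rfl fun d _ => ?_
  have hr : B.S hW c d * (B.S hW a f * pd d (om f e) * B.S hW b e) =
      sgn ((par d + (par f + par e + 1)) * (par b + par e + 1)
        + (par c + par d + 1) * (par a + par f + 1 + (par b + par e + 1))) •
        (B.S hW a f * B.S hW b e * B.S hW c d * pd d (om f e)) := by
    rw [mul_assoc, supercomm (pd_mem_parity d (h.om_parity f e)) (S_parity B hW b e),
      mul_smul_comm, mul_smul_comm, ← mul_assoc (B.S hW a f), ← mul_assoc (B.S hW c d),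
      supercomm (S_parity B hW c d) (mul_mem_parity (S_parity B hW a f) (S_parity B hW b e)),
      smul_mul_assoc, smul_smul, ← sgn_add]
  rw [S_symm B hW e b]
  simp only [mul_smul_comm]
  rw [hr]
  simp only [smul_smul, ← sgn_add]
  refine congrArg (fun x => sgn x • _) ?_
  rw [hamExp]
  ring

/-- After `ham_S` and reordering, the cyclic terms share the same product of three `S`, and their
coefficients assemble into `dω`. The sums are nested, with every sign outside the inner sum it does
not depend on, so that each `S` can be stripped off by invertibility. -/
theorem J0_eq (h : IsInv B hW om) (a b c : Idx n m) : B.J0 hW a b c =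
    sgn (par a * (par c + 1)) • ∑ f, B.S hW a f * (sgn (par b * par f) • ∑ e, B.S hW b e *
      (sgn (par c * (par f + par e + 1)) • ∑ d, B.S hW c d *
        (sgn (par d * par f + par d * par e + par e * par f) • dform om e f d))) := by
  have e2 : sgn ((par a + 1) * par b) • B.ham hW b (B.S hW c a) =
      -∑ f, ∑ e, ∑ d, sgn (hamExp (par c) (par a) (par b) (par d) (par f) (par e)) •
        (B.S hW c d * B.S hW a f * B.S hW b e * pd e (om d f)) := by
    rw [h.ham_S, sum_cycle]
  have e3 : sgn ((par c + 1) * par a) • B.ham hW a (B.S hW b c) =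
      -∑ f, ∑ e, ∑ d, sgn (hamExp (par b) (par c) (par a) (par e) (par d) (par f)) •
        (B.S hW b e * B.S hW c d * B.S hW a f * pd f (om e d)) := by
    rw [h.ham_S, sum_cycle, sum_cycle]
  rw [J0, h.ham_S, e2, e3]
  simp only [Finset.smul_sum, Finset.mul_sum, ← Finset.sum_neg_distrib, ← Finset.sum_add_distrib]
  refine Finset.sum_congr rfl fun f _ => Finset.sum_congr rfl fun e _ =>
    Finset.sum_congr rfl fun d _ => ?_
  have r2 : B.S hW c d * B.S hW a f * B.S hW b e =
      sgn ((par c + par d + 1) * (par a + par f + 1 + (par b + par e + 1))) •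
        (B.S hW a f * B.S hW b e * B.S hW c d) := by
    rw [mul_assoc, supercomm (S_parity B hW c d)
      (mul_mem_parity (S_parity B hW a f) (S_parity B hW b e))]
  have r3 : B.S hW b e * B.S hW c d * B.S hW a f =
      sgn ((par b + par e + 1 + (par c + par d + 1)) * (par a + par f + 1)) •
        (B.S hW a f * B.S hW b e * B.S hW c d) := by
    rw [supercomm (mul_mem_parity (S_parity B hW b e) (S_parity B hW c d)) (S_parity B hW a f),
      mul_assoc]
  rw [r2, r3, dform]
  simp only [smul_mul_assoc, mul_smul_comm, mul_add, smul_add, ← mul_assoc, smul_smul,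
    ← sgn_add, ← neg_smul]
  have hneg : ∀ p, -sgn p = sgn (p + 1) := fun p => by rw [sgn_add]; simp
  simp only [hneg]
  -- What remains is three identities between sign exponents in six variables over `ZMod 2`, each a
  -- finite check.
  generalize par a = a, par b = b, par c = c, par d = d, par e = e, par f = f
  congr 1
  · congr 1
    · refine congrArg (fun x => sgn x • _) ?_
      revert a b c d e f
      unfold hamExp
      decide
    · refine congrArg (fun x => sgn x • _) ?_
      revert a b c d e f
      unfold hamExp
      decide
  · refine congrArg (fun x => sgn x • _) ?_
    revert a b c d e f
    unfold hamExp
    decide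

theorem J0_eq_zero_iff (h : IsInv B hW om) :
    (∀ a b c, B.J0 hW a b c = 0) ↔ ∀ a b c, dform om a b c = 0 := by
  refine ⟨fun h0 e f d => ?_, fun h0 a b c => ?_⟩
  · have h1 : ∀ b c f, ∑ e, B.S hW b e *
        (sgn (par c * (par f + par e + 1)) • ∑ d, B.S hW c d *
        (sgn (par d * par f + par d * par e + par e * par f) • dform om e f d)) = 0 :=
      fun b c f => sgn_smul_eq_zero.1 <| h.eq_zero_of_S_mul (fun a => by
        have := h0 a b c
        rwa [h.J0_eq, sgn_smul_eq_zero] at this) f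
    have h2 : ∀ c f e, ∑ d, B.S hW c d *
        (sgn (par d * par f + par d * par e + par e * par f) • dform om e f d) = 0 :=
      fun c f e => sgn_smul_eq_zero.1 <| h.eq_zero_of_S_mul (fun b => h1 b c f) e
    exact sgn_smul_eq_zero.1 <| h.eq_zero_of_S_mul (fun c => h2 c f e) d
  · rw [h.J0_eq]
    simp [h0]

end IsInv
end BracketOn

/-! ### The 1-form `γₐ` and its closedness. -/

namespace BracketOn
variable {D : Opens (E n)} {B : BracketOn n m D} {hW : W ≤ D} {om : Idx n m → Idx n m → SF n m W}

/-- Lowering the index of `γ`. -/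
def low (B : BracketOn n m D) (hW : W ≤ D) (om : Idx n m → Idx n m → SF n m W) (a : Idx n m) :
    SF n m W :=
  ∑ b, om a b * B.gamma hW b

theorem ham_smul (a : Idx n m) (c : ℝ) (f : SF n m W) :
    B.ham hW a (c • f) = c • B.ham hW a f := by
  simp only [ham, map_smul, mul_smul_comm, Finset.smul_sum]

namespace IsInv

theorem low_parity (h : IsInv B hW om) (a : Idx n m) : low B hW om a ∈ parity n m W (par a) := by
  refine sum_mem fun b _ => ?_
  have := mul_mem_parity (h.om_parity a b) (B.gamma_parity hW b)
  have hs : ∀ a b : ZMod 2, a + b + 1 + (b + 1) = a := by decide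
  rwa [hs] at this

theorem gamma_eq (h : IsInv B hW om) (a : Idx n m) :
    B.gamma hW a = ∑ c, B.S hW a c * low B hW om c := by
  simp only [low, Finset.mul_sum, ← mul_assoc]
  rw [Finset.sum_comm]
  simp only [← Finset.sum_mul, h.S_mul]
  simp

theorem ham_gamma (h : IsInv B hW om) (b a : Idx n m) : B.ham hW b (B.gamma hW a) =
    ∑ c, B.ham hW b (B.S hW a c) * low B hW om c +
      ∑ c, ∑ d, sgn ((par b + 1) * (par a + par c + 1)) •
        (B.S hW a c * B.S hW b d * pd d (low B hW om c)) := by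
  rw [h.gamma_eq a, ham]
  simp only [map_sum, pd_mul (S_parity B hW a _), Finset.mul_sum, mul_add, Finset.sum_add_distrib]
  congr 1
  · rw [Finset.sum_comm]
    simp only [ham, Finset.sum_mul, mul_assoc]
  · rw [Finset.sum_comm]
    refine Finset.sum_congr rfl fun c _ => Finset.sum_congr rfl fun d _ => ?_
    rw [mul_smul_comm, ← mul_assoc, supercomm (S_parity B hW b d) (S_parity B hW a c),
      smul_mul_assoc, smul_smul, ← sgn_add]
    refine congrArg (fun x => sgn x • _) ?_
    generalize par a = a, par b = b, par c = c, par d = d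
    revert a b c d
    decide

/-- Rewriting `γᵃ∂ₐ` through `{x^d; ·}γ_d` gives `Γ(S^{ab})` the shape of one term of `J0`
contracted with `γ`. -/
theorem Gam_eq (h : IsInv B hW om) {p : ZMod 2} {f : SF n m W} (hf : f ∈ parity n m W p) :
    B.Gam hW f = ∑ d, sgn (par d * p) • (B.ham hW d f * low B hW om d) := by
  simp only [Gam, h.gamma_eq, ham, Finset.sum_mul, Finset.smul_sum]
  rw [Finset.sum_comm]
  refine Finset.sum_congr rfl fun d _ => Finset.sum_congr rfl fun e _ => ?_
  rw [mul_assoc, supercomm (h.low_parity d) (pd_mem_parity e hf), S_symm B hW e d, mul_smul_comm,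
    smul_mul_assoc, smul_smul, ← sgn_add, mul_assoc]
  have hs : ∀ d e p : ZMod 2, d * (e + p) + e * d = d * p := by decide
  rw [hs]

/-- With `γᵃ = S^{ac}γ_c`, the terms that differentiate `S` combine with `Γ(S^{ab})` into `J0`, and
the terms that differentiate `γ_c` form its exterior derivative. -/
theorem J1_eq (h : IsInv B hW om) (a b : Idx n m) : B.J1 hW a b =
    ∑ d, sgn (par a * par d) • (B.J0 hW a b d * low B hW om d) +
    sgn (par a) • ∑ c, B.S hW a c * (sgn (par c * (par b + 1)) • ∑ d, B.S hW b d *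
      (sgn (par c * par d) • pd c (low B hW om d) - pd d (low B hW om c))) := by
  have e1 : sgn ((par a + 1) * par b) • ∑ c, ∑ d, sgn ((par b + 1) * (par a + par c + 1)) •
        (B.S hW a c * B.S hW b d * pd d (low B hW om c)) =
      ∑ c, ∑ d, -sgn (par a + par c * (par b + 1)) •
        (B.S hW a c * B.S hW b d * pd d (low B hW om c)) := by
    simp only [Finset.smul_sum]
    refine Finset.sum_congr rfl fun c _ => Finset.sum_congr rfl fun d _ => ?_
    have hs : ∀ a b c : ZMod 2, (a + 1) * b + (b + 1) * (a + c + 1) = 1 + (a + c * (b + 1)) := by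
      decide
    rw [smul_smul, ← sgn_add, hs, sgn_add 1, sgn_one, neg_one_mul]
  have e2 : sgn (par a) • ∑ c, ∑ d, sgn ((par a + 1) * (par b + par c + 1)) •
        (B.S hW b c * B.S hW a d * pd d (low B hW om c)) =
      ∑ c, ∑ d, sgn (par a + par c * (par b + 1) + par c * par d) •
        (B.S hW a c * B.S hW b d * pd c (low B hW om d)) := by
    rw [Finset.sum_comm]
    simp only [Finset.smul_sum]
    refine Finset.sum_congr rfl fun c _ => Finset.sum_congr rfl fun d _ => ?_
    have hs : ∀ a b c d : ZMod 2, a + (a + 1) * (b + d + 1) + (b + d + 1) * (a + c + 1) =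
        a + c * (b + 1) + c * d := by
      decide
    rw [supercomm (S_parity B hW b d) (S_parity B hW a c), smul_mul_assoc, smul_smul, smul_smul,
      ← sgn_add, ← sgn_add, hs]
  have e3 : ∑ d, sgn (par a * par d) • (B.J0 hW a b d * low B hW om d) =
      B.Gam hW (B.S hW a b) +
      sgn ((par a + 1) * par b) • ∑ d, B.ham hW b (B.S hW a d) * low B hW om d +
      sgn (par a) • ∑ d, B.ham hW a (B.S hW b d) * low B hW om d := by
    rw [h.Gam_eq (S_parity B hW a b)]
    simp only [Finset.smul_sum, ← Finset.sum_add_distrib]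
    refine Finset.sum_congr rfl fun d _ => ?_
    have h1 : ∀ a b d : ZMod 2, a * d + (b + 1) * d = d * (a + b + 1) := by decide
    have h2 : ∀ a b d : ZMod 2, a * d + ((a + 1) * b + d * a) = (a + 1) * b := by decide
    have h3 : ∀ a d : ZMod 2, a * d + (d + 1) * a = a := by decide
    rw [J0, S_symm B hW d a, ham_smul, add_mul, add_mul, smul_add, smul_add]
    simp only [smul_mul_assoc, smul_smul, ← sgn_add, h1, h2, h3]
  rw [J1, h.ham_gamma, h.ham_gamma, smul_add, smul_add, e1, e2, e3]
  have e4 : sgn (par a) • ∑ c, B.S hW a c * (sgn (par c * (par b + 1)) • ∑ d, B.S hW b d *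
      (sgn (par c * par d) • pd c (low B hW om d) - pd d (low B hW om c))) =
      ∑ c, ∑ d, sgn (par a + par c * (par b + 1) + par c * par d) •
        (B.S hW a c * B.S hW b d * pd c (low B hW om d)) +
      ∑ c, ∑ d, -sgn (par a + par c * (par b + 1)) •
        (B.S hW a c * B.S hW b d * pd d (low B hW om c)) := by
    simp only [Finset.smul_sum, Finset.mul_sum, ← Finset.sum_add_distrib]
    refine Finset.sum_congr rfl fun c _ => Finset.sum_congr rfl fun d _ => ?_
    simp only [mul_sub, smul_sub, mul_smul_comm, smul_smul, ← sgn_add, mul_assoc, neg_smul]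
    rw [sub_eq_add_neg, add_assoc]
  rw [e4]
  abel

/-- Once `J0` vanishes, only the exterior derivative of `γ` is left in `J1_eq`, and both factors `S`
can be stripped. -/
theorem low_closed (h : IsInv B hW om) (h0 : ∀ a b c, B.J0 hW a b c = 0)
    (h1 : ∀ a b, B.J1 hW a b = 0) (c d : Idx n m) :
    pd d (low B hW om c) = sgn (par d * par c) • pd c (low B hW om d) := by
  have k1 : ∀ b c, ∑ d, B.S hW b d *
      (sgn (par c * par d) • pd c (low B hW om d) - pd d (low B hW om c)) = 0 := fun b c =>
    sgn_smul_eq_zero.1 <| h.eq_zero_of_S_mul (fun a => by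
      have := h1 a b
      rw [h.J1_eq] at this
      simp only [h0, zero_mul, smul_zero, Finset.sum_const_zero, zero_add] at this
      exact sgn_smul_eq_zero.1 this) c
  have k2 := h.eq_zero_of_S_mul (k1 · c) d
  rw [mul_comm (par d)]
  exact (sub_eq_zero.1 k2).symm

theorem low_eq_of_potential (h : IsInv B hW om) {A : SF n m W}
    (hgam : ∀ a, B.gamma hW a = -B.ham hW a A) (a : Idx n m) : low B hW om a = -pd a A := by
  rw [low, ← h.eq_of_S_mul a (Y := fun b => -pd b A)]
  intro a
  simp only [mul_neg, Finset.sum_neg_distrib]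
  exact (hgam a).symm

end IsInv

/-! ### Compatibility with restriction. -/

section res
variable {V : Opens (E n)} (hV : V ≤ W)

theorem res_S (a b : Idx n m) : SF.res hV (B.S hW a b) = B.S (hV.trans hW) a b := by
  rw [S, ← Dens.coeff_res, B.res, Dens.res_dens, Dens.res_dens, res_coord, res_coord]
  rfl

theorem res_gamma (a : Idx n m) : SF.res hV (B.gamma hW a) = B.gamma (hV.trans hW) a := by
  rw [gamma, ← Dens.coeff_res, B.res, Dens.res_dens, Dens.res_dens, res_coord, map_one (SF.res hV)]
  rfl

theorem res_theta : SF.res hV (B.theta hW) = B.theta (hV.trans hW) := by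
  rw [theta, ← Dens.coeff_res, B.res, Dens.res_dens, map_one (SF.res hV)]
  rfl

theorem res_ham (a : Idx n m) (f : SF n m W) :
    SF.res hV (B.ham hW a f) = B.ham (hV.trans hW) a (SF.res hV f) := by
  simp only [ham, map_sum, map_mul, res_S, pd_res]

theorem res_J0 (a b c : Idx n m) : SF.res hV (B.J0 hW a b c) = B.J0 (hV.trans hW) a b c := by
  simp only [J0, map_add, map_smul, res_ham, res_S]

theorem IsInv.res (h : IsInv B hW om) : IsInv B (hV.trans hW) fun a b => SF.res hV (om a b) where
  S_mul a c := by
    simp only [← res_S (hW := hW) hV, ← map_mul, ← map_sum, h.S_mul]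
    split_ifs <;> simp
  mul_S a c := by
    simp only [← res_S (hW := hW) hV, ← map_mul, ← map_sum, h.mul_S]
    split_ifs <;> simp

theorem res_low (a : Idx n m) : SF.res hV (low B hW om a) =
    low B (hV.trans hW) (fun a b => SF.res hV (om a b)) a := by
  simp only [low, map_sum, map_mul, res_gamma]

theorem res_jac (ψ χ φ : Dens n m W) (p q r : ZMod 2) :
    Dens.res hV (B.jac hW ψ χ φ p q r) =
      B.jac (hV.trans hW) (Dens.res hV ψ) (Dens.res hV χ) (Dens.res hV φ) p q r := by
  simp only [jac, map_add, map_smul, B.res]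

end res

/-- The function `γᵃ γₐ`, when `γ` has a potential. -/
theorem IsInv.sum_gamma_mul_low (h : IsInv B hW om) {A : SF n m W}
    (hgam : ∀ a, B.gamma hW a = -B.ham hW a A) :
    ∑ a, B.gamma hW a * low B hW om a = -B.Gam hW A := by
  simp only [h.low_eq_of_potential hgam, Gam, mul_neg, Finset.sum_neg_distrib]

end BracketOn

/-- Every point of an open set has a convex open neighbourhood in it. -/
theorem exists_convex_nhd {x : E n} (hx : x ∈ W) :
    ∃ (U : Opens (E n)) (_ : U ≤ W), x ∈ U ∧ Convex ℝ (U : Set (E n)) := by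
  obtain ⟨r, hr, hrW⟩ := Metric.isOpen_iff.1 W.isOpen x hx
  exact ⟨⟨Metric.ball x r, Metric.isOpen_ball⟩, hrW, Metric.mem_ball_self hr, convex_ball x r⟩

/-! ### The theorem in one chart. -/

namespace LongBracket
variable {M : Type*} [TopologicalSpace M] {X : Supermanifold n m M} {B : LongBracket X} {i : X.I}

theorem isInv (hS : IsUnit (B.S i)) : (B.on i).IsInv le_rfl (B.omega i) where
  S_mul a c := by
    have : (B.S i * B.omega i) a c = (1 : Matrix _ _ _) a c :=
      congrArg (fun M => M a c) (Ring.mul_inverse_cancel _ hS)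
    rwa [Matrix.mul_apply, Matrix.one_apply] at this
  mul_S a c := by
    have : (B.omega i * B.S i) a c = (1 : Matrix _ _ _) a c :=
      congrArg (fun M => M a c) (Ring.inverse_mul_cancel _ hS)
    rwa [Matrix.mul_apply, Matrix.one_apply] at this

/-- Parity, symmetry and non-degeneracy of `ω` are inherited from `S`; closedness is the only
condition. -/
theorem isOddSymplectic_iff (hS : IsUnit (B.S i)) :
    IsOddSymplectic (B.omega i) ↔ ∀ a b c, (B.on i).J0 le_rfl a b c = 0 := by
  rw [(isInv hS).J0_eq_zero_iff]
  refine ⟨fun h => h.closed, fun h => ⟨(isInv hS).om_parity, (isInv hS).om_symm, ?_, h⟩⟩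
  exact isUnit_iff_exists.2 ⟨B.S i, Ring.inverse_mul_cancel _ hS, Ring.mul_inverse_cancel _ hS⟩

/-- The bracket satisfies the Jacobi identity in the chart `i`. -/
def JacobiAt (B : LongBracket X) (i : X.I) : Prop :=
  ∀ (W : Opens (E n)) (hW : W ≤ X.dom i) (ψ χ φ : Dens n m W) (p q r : ZMod 2),
    ψ.HasParity p → χ.HasParity q → φ.HasParity r → (B.on i).jac hW ψ χ φ p q r = 0

theorem JacobiAt.J0_eq_zero (h : B.JacobiAt i) (hW : W ≤ X.dom i) (a b c : Idx n m) :
    (B.on i).J0 hW a b c = 0 := by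
  apply Dens.dens_injective 0
  rw [← BracketOn.jac_coord, Dens.dens_zero]
  exact h W hW _ _ _ _ _ _ (BracketOn.coord_parity a) (BracketOn.coord_parity b)
    (BracketOn.coord_parity c)

theorem JacobiAt.J1_eq_zero (h : B.JacobiAt i) (hW : W ≤ X.dom i) (a b : Idx n m) :
    (B.on i).J1 hW a b = 0 := by
  apply Dens.dens_injective 1
  rw [← BracketOn.jac_coord_coord_vol, Dens.dens_zero]
  exact h W hW _ _ _ _ _ _ (BracketOn.coord_parity a) (BracketOn.coord_parity b)
    (BracketOn.one_parity 1)

theorem JacobiAt.J2_eq_zero (h : B.JacobiAt i) (hW : W ≤ X.dom i) (a : Idx n m) :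
    (B.on i).J2 hW a = 0 := by
  apply Dens.dens_injective 2
  rw [← BracketOn.jac_coord_vol_vol, Dens.dens_zero]
  exact h W hW _ _ _ _ _ _ (BracketOn.coord_parity a) (BracketOn.one_parity 1)
    (BracketOn.one_parity 1)

theorem JacobiAt.exists_potential (h : B.JacobiAt i) (hS : IsUnit (B.S i)) {x : E n}
    (hx : x ∈ X.dom i) : ∃ (W : Opens (E n)) (hW : W ≤ X.dom i), x ∈ W ∧
      ∃ A ∈ parity n m W 0, ∀ a, (B.on i).gamma hW a = -(B.on i).ham hW a A := by
  obtain ⟨W, hW, hxW, hconv⟩ := exists_convex_nhd hx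
  have hinv := (isInv hS).res hW
  obtain ⟨A, hA, hAg⟩ := SF.exists_primitive hconv _ hinv.low_parity
    fun a b => hinv.low_closed (h.J0_eq_zero _) (h.J1_eq_zero _) b a
  -- `A` is a primitive of `γₐ`, whereas condition 2 asks for `γₐ = -∂ₐ𝒜`.
  refine ⟨W, hW, hxW, -A, neg_mem hA, fun a => ?_⟩
  rw [BracketOn.ham_neg, neg_neg, hinv.gamma_eq a, BracketOn.ham]
  simp only [hAg]

/-- For a potential `A`, the contraction `γᵃγₐ` is `-Γ(A)`. -/
theorem theta_eq_iff (hS : IsUnit (B.S i)) {hW : W ≤ X.dom i} {A : SF n m W}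
    (hgam : ∀ a, (B.on i).gamma hW a = -(B.on i).ham hW a A) :
    SF.res hW (B.theta i) = SF.res hW (∑ a, B.gamma i a * B.gammaLow i a) ↔
      (B.on i).theta hW = -(B.on i).Gam hW A := by
  rw [← ((isInv hS).res hW).sum_gamma_mul_low hgam]
  have h1 : SF.res hW (B.theta i) = (B.on i).theta hW :=
    BracketOn.res_theta (B := B.on i) (hW := le_rfl) hW
  have h2 : SF.res hW (∑ a, B.gamma i a * B.gammaLow i a) = ∑ a, (B.on i).gamma hW a *
      (B.on i).low hW (fun a b => SF.res hW (B.omega i a b)) a := by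
    rw [map_sum]
    refine Finset.sum_congr rfl fun a _ => ?_
    rw [map_mul]
    exact congrArg₂ (· * ·) (BracketOn.res_gamma (B := B.on i) (hW := le_rfl) hW a)
      (BracketOn.res_low (B := B.on i) (hW := le_rfl) (om := B.omega i) hW a)
  rw [h1, h2]

/-- Locally `J2` says that every `{xᵃ; ·}` kills `θ + Γ(A)`. By non-degeneracy its derivatives
vanish, and being odd it is zero. -/
theorem JacobiAt.theta_eq (h : B.JacobiAt i) (hS : IsUnit (B.S i)) :
    B.theta i = ∑ a, B.gamma i a * B.gammaLow i a := by
  refine SF.ext_res fun x hx => ?_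
  obtain ⟨W, hW, hxW, A, hA, hgam⟩ := h.exists_potential hS hx
  refine ⟨W, hW, hxW, (theta_eq_iff hS hgam).2 ?_⟩
  rw [eq_neg_iff_add_eq_zero]
  refine SF.eq_zero_of_pd_eq_zero (add_mem (BracketOn.theta_parity _ _) ?_)
    (((isInv hS).res hW).eq_zero_of_ham fun a => ?_)
  · have := (B.on i).Gam_parity hW hA
    rwa [zero_add] at this
  · have := h.J2_eq_zero hW a
    rwa [BracketOn.J2_eq hA hgam (h.J0_eq_zero hW), BracketOn.sgn_smul_eq_zero] at this

/-- Equality of densities is local, so it suffices to argue on intersections of `W` with the domains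
of the potentials. -/
theorem jacobiAt_of_potential (hS : IsUnit (B.S i)) (h0 : ∀ a b c, (B.on i).J0 le_rfl a b c = 0)
    (hpot : ∀ x ∈ X.dom i, ∃ (W : Opens (E n)) (hW : W ≤ X.dom i), x ∈ W ∧
      ∃ A ∈ parity n m W 0, ∀ a, (B.on i).gamma hW a = -(B.on i).ham hW a A)
    (hth : B.theta i = ∑ a, B.gamma i a * B.gammaLow i a) : B.JacobiAt i := by
  intro W hW ψ χ φ p q r hψ hχ hφ
  refine Dens.ext_res fun x hx => ?_
  obtain ⟨V, hV, hxV, A, hA, hgam⟩ := hpot x (hW hx)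
  have hUW : V ⊓ W ≤ W := inf_le_right
  have hUV : V ⊓ W ≤ V := inf_le_left
  refine ⟨V ⊓ W, hUW, ⟨hxV, hx⟩, ?_⟩
  have hgam' : ∀ a, (B.on i).gamma (hUV.trans hV) a =
      -(B.on i).ham (hUV.trans hV) a (SF.res hUV A) := fun a => by
    rw [← BracketOn.res_gamma (hW := hV), hgam, map_neg, BracketOn.res_ham]
  rw [BracketOn.res_jac, map_zero]
  refine BracketOn.jac_eq_zero_of_potential (res_mem_parity hUV hA) hgam' (fun a b c => ?_)
    ((theta_eq_iff hS hgam').1 (congrArg _ hth)) (hψ.res _) (hχ.res _) (hφ.res _)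
  rw [← BracketOn.res_J0 (hW := le_rfl) (hUV.trans hV), h0, map_zero]

/-- The Jacobi identity in a chart for a non-degenerate long bracket. -/
theorem jacobiAt_iff (hS : IsUnit (B.S i)) : B.JacobiAt i ↔
    IsOddSymplectic (B.omega i) ∧
    (∀ x ∈ X.dom i, ∃ (W : Opens (E n)) (hW : W ≤ X.dom i), x ∈ W ∧ ∃ A ∈ parity n m W 0,
      ∀ a, SF.res hW (B.gamma i a) = -∑ b, SF.res hW (B.S i a b) * pd b A) ∧
    B.theta i = ∑ a, B.gamma i a * B.gammaLow i a := by
  have hpot : ∀ {W : Opens (E n)} (hW : W ≤ X.dom i) (A : SF n m W) (a : Idx n m),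
      (SF.res hW (B.gamma i a) = -∑ b, SF.res hW (B.S i a b) * pd b A) ↔
      ((B.on i).gamma hW a = -(B.on i).ham hW a A) := fun hW A a => by
    have h1 : SF.res hW (B.gamma i a) = (B.on i).gamma hW a :=
      BracketOn.res_gamma (B := B.on i) (hW := le_rfl) hW a
    have h2 : ∀ b, SF.res hW (B.S i a b) = (B.on i).S hW a b :=
      BracketOn.res_S (B := B.on i) (hW := le_rfl) hW a
    simp only [h1, h2]
    rfl
  simp only [hpot]
  rw [isOddSymplectic_iff hS]
  exact ⟨fun h => ⟨h.J0_eq_zero le_rfl, fun x hx => h.exists_potential hS hx, h.theta_eq hS⟩,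
    fun h => jacobiAt_of_potential hS h.1 h.2.1 h.2.2⟩

end LongBracket

end OddLongBracket

end

theorem mainTheorem6 {n m : ℕ} {M : Type*} [TopologicalSpace M]
    (X : OddLongBracket.Supermanifold n m M) (B : OddLongBracket.LongBracket X)
    (hS : ∀ i, IsUnit (B.S i)) :
    B.Jacobi ↔
      (∀ i, OddLongBracket.IsOddSymplectic (B.omega i)) ∧
      (∀ i, ∀ x ∈ X.dom i, ∃ (W : TopologicalSpace.Opens (OddLongBracket.E n))
        (hW : W ≤ X.dom i), x ∈ W ∧ ∃ A ∈ OddLongBracket.parity n m W 0,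
          ∀ a, OddLongBracket.SF.res hW (B.gamma i a) =
            -∑ b, OddLongBracket.SF.res hW (B.S i a b) * OddLongBracket.pd b A) ∧
      (∀ i, B.theta i = ∑ a, B.gamma i a * B.gammaLow i a) := by
  have h : B.Jacobi ↔ ∀ i, B.JacobiAt i := Iff.rfl
  rw [h, forall_congr' fun i => OddLongBracket.LongBracket.jacobiAt_iff (hS i), forall_and,
    forall_and]
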